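/- Let $n\ge 2$ and let $\alpha\subset\mathbb R^n$ be a germ at a point $O$ of $C^6$-smooth hypersurface with positive definite second fundamental form (with the sign convention that it is positive definite for a round sphere); for $A\in\alpha$ let $\vec n(A)\in S^{n-1}$ denote the exterior unit normal to $\alpha$ at $A$, i.e. the one pointing away from the side towards which $\alpha$ is curved. For a class $\mathcal L$ of parallel lines let $\mathcal R_{\mathcal L}$ be the involution, defined on a part of the unit sphere $S^{n-1}$, given by $\mathcal R_{\mathcal L}(\vec n(A))=\vec n(B)$ whenever $A,B$ are the two intersection points with $\alpha$ of a line from $\mathcal L$, with $A=B$ in the case of tangency. Suppose that there is a representative of the germ (again denoted by $\alpha$) such that, for every class $\mathcal L$ of parallel lines that contains at least one line meeting $\alpha$ twice, $\mathcal R_{\mathcal L}$ is a lifting of some projective involution $f_{\mathcal L}:\mathbb{RP}^{n-1}\to\mathbb{RP}^{n-1}$, that is, $\pi\circ\mathcal R_{\mathcal L}=f_{\mathcal L}\circ\pi$ wherever $\mathcal R_{\mathcal L}$ is defined, where $\pi:S^{n-1}\to\mathbb{RP}^{n-1}$ is the tautological projection sending a unit vector to the line it spans. Then $\alpha$ is a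 quadric: in a neighbourhood of $O$ it coincides with the zero set of a real polynomial of degree two. -/

import Mathlib

open Filter Topology

noncomputable section

namespace ProjBilliard

/-- The Euclidean space `ℝⁿ`. -/
abbrev Euc (n : ℕ) : Type := EuclideanSpace ℝ (Fin n)

/-- `F` is a local defining function at the point `O` of the germ at `O` of the set `α`: the germ
is a `C⁶`-smooth germ of hypersurface, given near `O` by the regular equation `F = 0`.
This depends only on the germs at `O` of `α` and of `F`. -/
structure IsDefiningFunctionAt {n : ℕ} (F : Euc n → ℝ) (α : Set (Euc n)) (O : Euc n) : Prop where
  mem : O ∈ α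
  contDiffAt : ContDiffAt ℝ 6 F O
  gradient_ne_zero : gradient F O ≠ 0
  eventually_mem_iff : ∀ᶠ x in 𝓝 O, (x ∈ α ↔ F x = 0)

/-- The unit normal field `∇F / ‖∇F‖` of the level sets of `F`, on the side to which `F` grows. -/
def unitNormal {n : ℕ} (F : Euc n → ℝ) (x : Euc n) : Euc n :=
  ‖gradient F x‖⁻¹ • gradient F x

/-- The second fundamental form at `x` of the level hypersurface of `F` through `x`, as the bilinear
form of the derivative of the Gauss map: `II(u, w) = ⟪dN(u), w⟫` for tangent vectors `u`, `w`, where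
`N` is the unit normal field above. The sign is such that it is positive definite for the unit
sphere with the exterior normal `N(x) = x`. -/
def secondFundamentalForm {n : ℕ} (F : Euc n → ℝ) (x u w : Euc n) : ℝ :=
  inner ℝ (fderiv ℝ (unitNormal F) x u) w

/-- The second fundamental form of `{F = 0}` at `x` is positive definite on the tangent hyperplane,
with respect to the normal `unitNormal F`; that is, `unitNormal F` is the exterior normal of the
locally strictly convex hypersurface. -/
def HasPosDefSecondFundamentalForm {n : ℕ} (F : Euc n → ℝ) (x : Euc n) : Prop :=
  ∀ u : Euc n, inner ℝ (gradient F x) u = 0 → u ≠ 0 → 0 < secondFundamentalForm F x u u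

/-- The points `A`, `B` of the hypersurface `α` are the two intersection points with `α` of a line
parallel to `v`, confluent to one point if the line is tangent to `α` there. -/
def IsChord {n : ℕ} (F : Euc n → ℝ) (α : Set (Euc n)) (v A B : Euc n) : Prop :=
  A ∈ α ∧ B ∈ α ∧ (∃ t : ℝ, B = A + t • v) ∧ (A ≠ B ∨ (A = B ∧ inner ℝ (gradient F A) v = 0))

/-- The graph of the involution on (the part covered by the normals of `α` of) the unit sphere
that is defined by the class of lines parallel to `v`: it sends the exterior normal at one
intersection point of a line with `α` to the exterior normal at the other one. -/
def LineInvolution {n : ℕ} (F : Euc n → ℝ) (α : Set (Euc n)) (v : Euc n)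
    (a b : Metric.sphere (0 : Euc n) 1) : Prop :=
  ∃ A B : Euc n, IsChord F α v A B ∧ (a : Euc n) = unitNormal F A ∧ (b : Euc n) = unitNormal F B

/-- The tautological projection of the unit sphere to the projective space. -/
def tautProj {n : ℕ} (a : Metric.sphere (0 : Euc n) 1) : Projectivization ℝ (Euc n) :=
  Projectivization.mk ℝ (a : Euc n) (ne_zero_of_mem_unit_sphere a)

/-- A projective transformation (induced by a linear automorphism) that is an involution. -/
def IsProjectiveInvolution {n : ℕ}
    (f : Projectivization ℝ (Euc n) → Projectivization ℝ (Euc n)) : Prop :=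
  (∃ M : Euc n ≃ₗ[ℝ] Euc n, f = Projectivization.map M.toLinearMap M.injective) ∧
    Function.Involutive f

/-- The partially defined map of the unit sphere with graph `R` is a lifting of `f`. -/
def IsLiftOf {n : ℕ} (R : Metric.sphere (0 : Euc n) 1 → Metric.sphere (0 : Euc n) 1 → Prop)
    (f : Projectivization ℝ (Euc n) → Projectivization ℝ (Euc n)) : Prop :=
  ∀ a b, R a b → f (tautProj a) = tautProj b

/-- Some line parallel to `v` meets `α` at (at least) two points. -/
def MeetsTwice {n : ℕ} (α : Set (Euc n)) (v : Euc n) : Prop :=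
  ∃ A ∈ α, ∃ B ∈ α, A ≠ B ∧ ∃ t : ℝ, B = A + t • v

/-- A quadric: the zero locus of a real polynomial of degree two. -/
def IsQuadric {n : ℕ} (Γ : Set (Euc n)) : Prop :=
  ∃ (q : QuadraticForm ℝ (Euc n)) (l : Euc n →ₗ[ℝ] ℝ) (c : ℝ),
    q ≠ 0 ∧ Γ = {x | q x + l x + c = 0}

end ProjBilliard

end

/-! Adding a large multiple of `F²` to `F` makes the full Hessian `Q` at `O` positive definite
without changing the hypersurface or its normals, so near `O` it bounds a uniformly convex sublevel
set.

Fix a direction `v`. Where a line parallel to `v` is tangent, the involution fixes the normal, and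
such normals fill an open piece of `v^⊥`. A linear map inducing the involution is therefore scalar
on `v^⊥`, hence scalar or a harmonic homology. It is not scalar, because the outward derivatives
along a chord have opposite signs at its ends. Dually, there is `ω` with `ω v = 1` such that the
linear reflection `x ↦ x - 2 ω(x) v` exchanges the tangent hyperplanes at the ends of every chord
parallel to `v` (`exists_homology`).

Let `v` be tangent at `O`. The homology then says that midpoints of chords parallel to `v` move
along `ker ω`. Shrinking the chords to `O` puts all midpoints in `O + ker ω`, so the affine
reflection preserves a cap of the patch (`chord_symmetric`, `reflection_mem_cap`). On the tangent
hyperplane it is the `Q`-orthogonal reflection in `v` (`homology_apply_tangent`). The mirrors of an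
orthogonal basis share a transversal axis. A mirror missing this axis would produce a shear
translating a point of a horizontal section twice by the same vector, against strict convexity.
Hence every mirror contains the axis and the cap is a body of revolution for `Q` (`exists_axis`,
`rotation_mem_cap`).

It remains to identify the profile, an even curve `ζ`. Chords of an arbitrary slope `s` induce a
Möbius involution on the tangent slopes, and differentiating it shows that `P''`, with `P =
(ζ'')^(-2/3)`, agrees at both ends of each chord (`affine_curvature_eq`); up to a constant factor
`P''` is the equi-affine curvature. Any two points span a chord, so `P''` is constant, `P` is a
quadratic polynomial, and integration gives a conic (`even_curve_conic`). Rotating this conic gives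
the quadric. -/

noncomputable section

namespace ProjBilliard

/-! ### Plane curves whose parallel chords act projectively on tangents -/

/-- The implicit function theorem for a scalar equation in two real variables. -/
theorem exists_implicit_real {G : ℝ × ℝ → ℝ} {x y : ℝ} {n : WithTop ℕ∞} (hn : n ≠ 0)
    (hG : ContDiffAt ℝ n G (x, y)) (h0 : G (x, y) = 0) (hy : fderiv ℝ G (x, y) (0, 1) ≠ 0) :
    ∃ φ : ℝ → ℝ, φ x = y ∧ ContDiffAt ℝ n φ x ∧ (∀ᶠ t in 𝓝 x, G (t, φ t) = 0) ∧
      ∀ᶠ u in 𝓝 (x, y), G u = 0 → u.2 = φ u.1 := by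
  have hinv : (fderiv ℝ G (x, y) ∘L .inr ℝ ℝ ℝ).IsInvertible := by
    refine ⟨ContinuousLinearEquiv.unitsEquivAut ℝ (Units.mk0 _ hy), ?_⟩
    ext
    simp
  refine ⟨hG.implicitFunction hn hinv, hG.implicitFunction_apply_self hn hinv,
    hG.contDiffAt_implicitFunction hn hinv, ?_, ?_⟩
  · filter_upwards [hG.eventually_apply_implicitFunction hn hinv] with t ht
    rw [ht, h0]
  · filter_upwards [hG.eventually_apply_eq_iff_implicitFunction hn hinv] with u hu h
    exact (hu.1 (h.trans h0.symm)).symm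

/-- Partner of a point of a graph with respect to the lines of slope `s`. -/
theorem exists_chord_partner {ζ : ℝ → ℝ} {t₁ t₂ s : ℝ} (h₁ : ContDiffAt ℝ 1 ζ t₁)
    (h₂ : ContDiffAt ℝ 1 ζ t₂) (hs : ζ t₂ - ζ t₁ = s * (t₂ - t₁)) (hne : deriv ζ t₂ ≠ s) :
    ∃ X : ℝ → ℝ, X t₁ = t₂ ∧ ContDiffAt ℝ 1 X t₁ ∧
      ∀ᶠ t in 𝓝 t₁, ζ (X t) - ζ t = s * (X t - t) := by
  set G : ℝ × ℝ → ℝ := fun u => ζ u.2 - ζ u.1 - s * (u.2 - u.1) with hGdef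
  have hG : ContDiffAt ℝ 1 G (t₁, t₂) := by
    have ha : ContDiffAt ℝ 1 (fun u : ℝ × ℝ => ζ u.2) (t₁, t₂) :=
      ContDiffAt.comp (t₁, t₂) (g := ζ) (f := Prod.snd) h₂ contDiffAt_snd
    have hb : ContDiffAt ℝ 1 (fun u : ℝ × ℝ => ζ u.1) (t₁, t₂) :=
      ContDiffAt.comp (t₁, t₂) (g := ζ) (f := Prod.fst) h₁ contDiffAt_fst
    exact (ha.sub hb).sub (contDiffAt_const.mul (contDiffAt_snd.sub contDiffAt_fst))
  have hder : fderiv ℝ G (t₁, t₂) (0, 1) = deriv ζ t₂ - s := by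
    have hline : HasDerivAt (fun y : ℝ => ((t₁, y) : ℝ × ℝ)) (0, 1) t₂ :=
      (hasDerivAt_const t₂ t₁).prodMk (hasDerivAt_id t₂)
    have e1 := (hG.differentiableAt one_ne_zero).hasFDerivAt.comp_hasDerivAt t₂ hline
    have e2 : HasDerivAt (fun y : ℝ => ζ y - ζ t₁ - s * (y - t₁)) (deriv ζ t₂ - s * 1) t₂ :=
      ((h₂.differentiableAt one_ne_zero).hasDerivAt.sub_const _).sub
        (((hasDerivAt_id t₂).sub_const t₁).const_mul s)
    simpa using e1.unique e2
  obtain ⟨φ, h1, h2, h3, -⟩ := exists_implicit_real one_ne_zero hG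
    (by simp [hGdef, hs]) (by rw [hder]; exact sub_ne_zero.2 hne)
  refine ⟨φ, h1, h2, ?_⟩
  filter_upwards [h3] with t ht
  simpa [hGdef, sub_eq_zero] using ht

/-- Two differentiable functions that agree near a point have the same derivative there. -/
theorem eventually_deriv_unique {f g f' g' : ℝ → ℝ} {x : ℝ} (h : ∀ᶠ t in 𝓝 x, f t = g t)
    (hf : ∀ᶠ t in 𝓝 x, HasDerivAt f (f' t) t) (hg : ∀ᶠ t in 𝓝 x, HasDerivAt g (g' t) t) :
    ∀ᶠ t in 𝓝 x, f' t = g' t := by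
  filter_upwards [h.eventually_nhds, hf, hg] with t h1 h2 h3
  exact h2.unique (h3.congr_of_eventuallyEq h1)

/-- Invariance of the equi-affine curvature under the affine reflection exchanging the endpoints of
a chord: if `P = (ζ'')^(-2/3)`, then `P''` takes the same value at both endpoints. -/
theorem affine_curvature_eq {ζ z₁ z₂ z₃ P P₁ P₂ : ℝ → ℝ} {I : Set ℝ} (hI : IsOpen I)
    (hζ : ∀ t ∈ I, ContDiffAt ℝ 1 ζ t)
    (h₁ : ∀ t ∈ I, HasDerivAt ζ (z₁ t) t) (h₂ : ∀ t ∈ I, HasDerivAt z₁ (z₂ t) t)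
    (h₃ : ∀ t ∈ I, HasDerivAt z₂ (z₃ t) t) (hpos : ∀ t ∈ I, 0 < z₂ t)
    (hP : ∀ t ∈ I, 0 < P t) (hPz : ∀ t ∈ I, P t ^ 3 * z₂ t ^ 2 = 1)
    (hP₁ : ∀ t ∈ I, HasDerivAt P (P₁ t) t) (hP₂ : ∀ t ∈ I, HasDerivAt P₁ (P₂ t) t)
    {t₁ t₂ s c : ℝ} (ht₁ : t₁ ∈ I) (ht₂ : t₂ ∈ I) (hne : t₁ ≠ t₂)
    (hs : ζ t₂ - ζ t₁ = s * (t₂ - t₁)) (hs₁ : z₁ t₁ ≠ s) (hs₂ : z₁ t₂ ≠ s)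
    (hc : ∀ t ∈ I, ∀ X ∈ I, t ≠ X → ζ X - ζ t = s * (X - t) →
      (z₁ X - s) * (1 + c * (z₁ t - s)) = -(z₁ t - s)) :
    P₂ t₁ = P₂ t₂ := by
  -- Move the chord with its slope fixed: `X t` is the far end of the chord of slope `s` through
  -- `t`.
  obtain ⟨X, hX, hXd, hXs⟩ := exists_chord_partner (hζ t₁ ht₁) (hζ t₂ ht₂) hs
    (by rw [(h₁ t₂ ht₂).deriv]; exact hs₂)
  have hXcont : Tendsto X (𝓝 t₁) (𝓝 t₂) := hX ▸ hXd.continuousAt.tendsto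
  have evI : ∀ᶠ t in 𝓝 t₁, t ∈ I := hI.mem_nhds ht₁
  have evX : ∀ᶠ t in 𝓝 t₁, X t ∈ I := hXcont.eventually (hI.mem_nhds ht₂)
  have evne : ∀ᶠ t in 𝓝 t₁, t ≠ X t := by
    have : ∀ᶠ t in 𝓝 t₁, t - X t ≠ 0 :=
      (tendsto_id.sub hXcont).eventually_ne (sub_ne_zero.2 hne)
    filter_upwards [this] with t ht using sub_ne_zero.1 ht
  have evd : ∀ᶠ t in 𝓝 t₁, DifferentiableAt ℝ X t := by
    filter_upwards [hXd.eventually (by simp)] with t ht using ht.differentiableAt one_ne_zero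
  have evD : ∀ᶠ t in 𝓝 t₁, z₁ (X t) ≠ s :=
    ((h₂ t₂ ht₂).continuousAt.tendsto.comp hXcont).eventually_ne hs₂
  have evd0 : ∀ᶠ t in 𝓝 t₁, z₁ t ≠ s := (h₂ t₁ ht₁).continuousAt.eventually_ne hs₁
  have ev1 : ∀ᶠ t in 𝓝 t₁, (z₁ (X t) - s) * (1 + c * (z₁ t - s)) = -(z₁ t - s) := by
    filter_upwards [evI, evX, evne, hXs] with t a1 a2 a3 a4 using hc t a1 _ a2 a3 a4
  have evY : ∀ᶠ t in 𝓝 t₁, 1 + c * (z₁ t - s) ≠ 0 := by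
    filter_upwards [ev1, evd0] with t a1 a2 h
    rw [h, mul_zero] at a1
    exact a2 (by linarith)
  -- Put `Y = 1 + c (ζ' - s)`. The differentiated chord equation is `(ζ'(X) - s) X' = ζ' - s`, and
  -- the involution rewrites the right side as `-(ζ'(X) - s) Y`, so `X' = -Y`.
  have evX1 : ∀ᶠ t in 𝓝 t₁, HasDerivAt X (-(1 + c * (z₁ t - s))) t := by
    have e := eventually_deriv_unique (f' := fun t => z₁ (X t) * deriv X t - z₁ t)
      (g' := fun t => s * (deriv X t - 1)) hXs
      (by
        filter_upwards [evI, evX, evd] with t a1 a2 a3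
        exact ((h₁ _ a2).comp t a3.hasDerivAt).sub (h₁ t a1))
      (by
        filter_upwards [evd] with t a3
        exact (a3.hasDerivAt.sub (hasDerivAt_id t)).const_mul s)
    filter_upwards [e, evd, evD, ev1] with t a1 a2 a3 a4
    have : (z₁ (X t) - s) * deriv X t = (z₁ (X t) - s) * -(1 + c * (z₁ t - s)) := by linarith
    rw [← mul_left_cancel₀ (sub_ne_zero.2 a3) this]
    exact a2.hasDerivAt
  have evY1 : ∀ᶠ t in 𝓝 t₁, HasDerivAt (fun t => 1 + c * (z₁ t - s)) (c * z₂ t) t := by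
    filter_upwards [evI] with t a1
    exact (((h₂ t a1).sub_const s).const_mul c).const_add 1
  have ev2 : ∀ᶠ t in 𝓝 t₁, z₂ (X t) * (1 + c * (z₁ t - s)) ^ 3 = z₂ t := by
    have e := eventually_deriv_unique
      (f' := fun t => (z₂ (X t) * -(1 + c * (z₁ t - s))) * (1 + c * (z₁ t - s)) +
        (z₁ (X t) - s) * (c * z₂ t)) (g' := fun t => - z₂ t) ev1
      (by
        filter_upwards [evI, evX, evX1, evY1] with t a1 a2 a3 a4
        exact (((h₂ _ a2).comp t a3).sub_const s).mul a4)
      (by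
        filter_upwards [evI] with t a1
        exact ((h₂ t a1).sub_const s).neg)
    filter_upwards [e, ev1] with t a1 a2
    linear_combination (-(1 + c * (z₁ t - s))) * a1 + c * z₂ t * a2
  -- The exponent `-2/3` turns the transformation law `ζ''(X) Y³ = ζ''` into `P(X) = P Y²`.
  have ev3 : ∀ᶠ t in 𝓝 t₁, P (X t) = P t * (1 + c * (z₁ t - s)) ^ 2 := by
    filter_upwards [evI, evX, ev2] with t a1 a2 a3
    have hz := hpos t a1
    have hz' := hpos _ a2
    have k1 := hPz t a1
    have k2 := hPz _ a2
    set Y := 1 + c * (z₁ t - s)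
    have h6 : P (X t) ^ 3 = (P t * Y ^ 2) ^ 3 := by
      have : (P (X t) ^ 3 - (P t * Y ^ 2) ^ 3) * z₂ (X t) ^ 2 = 0 := by
        rw [← a3] at k1
        linear_combination k2 - k1
      rcases mul_eq_zero.1 this with h | h
      · linarith
      · exact absurd h (by positivity)
    have hp := hP t a1
    exact (pow_left_inj₀ (hP _ a2).le (by positivity) three_ne_zero).1 h6
  have ev4 : ∀ᶠ t in 𝓝 t₁, P₁ (X t) * (1 + c * (z₁ t - s)) =
      -(P₁ t * (1 + c * (z₁ t - s)) ^ 2 + P t * (2 * (1 + c * (z₁ t - s)) * (c * z₂ t))) := by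
    have e := eventually_deriv_unique
      (f' := fun t => P₁ (X t) * -(1 + c * (z₁ t - s)))
      (g' := fun t => P₁ t * (1 + c * (z₁ t - s)) ^ 2 +
        P t * (2 * (1 + c * (z₁ t - s)) * (c * z₂ t))) ev3
      (by
        filter_upwards [evX, evX1] with t a2 a3
        exact (hP₁ _ a2).comp t a3)
      (by
        filter_upwards [evI, evY1] with t a1 a4
        exact ((hP₁ t a1).mul (a4.pow 2)).congr_deriv (by simp))
    filter_upwards [e] with t a
    linarith
  have ev5 : ∀ᶠ t in 𝓝 t₁, P₁ (X t) = -(P₁ t * (1 + c * (z₁ t - s))) - 2 * c * (P t * z₂ t) := by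
    filter_upwards [ev4, evY] with t a1 a2
    exact mul_right_cancel₀ a2 (by linear_combination a1)
  -- The second differentiation leaves the extra term `c (3 P' ζ'' + 2 P ζ''')`, which vanishes
  -- because `P³ (ζ'')²` is constant.
  have ev6 : ∀ᶠ t in 𝓝 t₁, P₂ (X t) * (1 + c * (z₁ t - s)) = P₂ t * (1 + c * (z₁ t - s)) := by
    have e := eventually_deriv_unique
      (f' := fun t => P₂ (X t) * -(1 + c * (z₁ t - s)))
      (g' := fun t => -(P₂ t * (1 + c * (z₁ t - s)) + P₁ t * (c * z₂ t)) -
        2 * c * (P₁ t * z₂ t + P t * z₃ t)) ev5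
      (by
        filter_upwards [evX, evX1] with t a2 a3
        exact (hP₂ _ a2).comp t a3)
      (by
        filter_upwards [evI, evY1] with t a1 a4
        exact ((hP₂ t a1).mul a4).neg.sub (((hP₁ t a1).mul (h₃ t a1)).const_mul _))
    have e' := eventually_deriv_unique (f := fun t => P t ^ 3 * z₂ t ^ 2) (g := fun _ => 1)
      (f' := fun t => (3 * P t ^ 2 * P₁ t) * z₂ t ^ 2 + P t ^ 3 * (2 * z₂ t * z₃ t))
      (g' := fun _ => 0) (x := t₁) (by filter_upwards [evI] with t a1 using hPz t a1)
      (by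
        filter_upwards [evI] with t a1
        exact (((hP₁ t a1).pow 3).mul ((h₃ t a1).pow 2)).congr_deriv (by simp))
      (Eventually.of_forall fun t => hasDerivAt_const t 1)
    filter_upwards [e, e', evI] with t a1 a2 a3
    have hp := hP t a3
    have hz := hpos t a3
    have a4 : 3 * P₁ t * z₂ t + 2 * P t * z₃ t = 0 := by
      have : (P t ^ 2 * z₂ t) * (3 * P₁ t * z₂ t + 2 * P t * z₃ t) = 0 := by linarith
      rcases mul_eq_zero.1 this with h | h
      · exact absurd h (by positivity)
      · exact h
    linear_combination -a1 + c * a4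
  have := mul_right_cancel₀ evY.self_of_nhds ev6.self_of_nhds
  rw [hX] at this
  exact this.symm

theorem eq_of_hasDerivAt_eq {f g d : ℝ → ℝ} {a b x : ℝ}
    (hf : ∀ t ∈ Set.Ioo a b, HasDerivAt f (d t) t) (hg : ∀ t ∈ Set.Ioo a b, HasDerivAt g (d t) t)
    (hx : x ∈ Set.Ioo a b) (h : f x = g x) : ∀ t ∈ Set.Ioo a b, f t = g t :=
  isOpen_Ioo.eqOn_of_deriv_eq isPreconnected_Ioo
    (fun t ht => (hf t ht).differentiableAt.differentiableWithinAt)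
    (fun t ht => (hg t ht).differentiableAt.differentiableWithinAt)
    (fun t ht => (hf t ht).deriv.trans (hg t ht).deriv.symm) hx h

/-- Explicit integration of `ζ'' = (k² + A t²)^(-3/2)` with vanishing initial conditions. -/
theorem conic_of_second_deriv {ζ z₁ z₂ : ℝ → ℝ} {ε A k : ℝ} (hε : 0 < ε) (hk : 0 < k)
    (h₁ : ∀ t ∈ Set.Ioo (-ε) ε, HasDerivAt ζ (z₁ t) t)
    (h₂ : ∀ t ∈ Set.Ioo (-ε) ε, HasDerivAt z₁ (z₂ t) t)
    (hpos : ∀ t ∈ Set.Ioo (-ε) ε, 0 < z₂ t) (hP : ∀ t ∈ Set.Ioo (-ε) ε, 0 < k ^ 2 + A * t ^ 2)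
    (hz : ∀ t ∈ Set.Ioo (-ε) ε, (k ^ 2 + A * t ^ 2) ^ 3 * z₂ t ^ 2 = 1)
    (h0 : ζ 0 = 0) (h0' : z₁ 0 = 0) {t : ℝ} (ht : t ∈ Set.Ioo (-ε) ε) :
    t ^ 2 = A * k ^ 4 * ζ t ^ 2 + 2 * k ^ 3 * ζ t := by
  have hmem : (0 : ℝ) ∈ Set.Ioo (-ε) ε := ⟨by linarith, hε⟩
  have hS : ∀ t ∈ Set.Ioo (-ε) ε, HasDerivAt (fun t => √(k ^ 2 + A * t ^ 2))
      (A * t / √(k ^ 2 + A * t ^ 2)) t := by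
    intro t ht
    have h : HasDerivAt (fun t : ℝ => k ^ 2 + A * t ^ 2) (A * (2 * t)) t := by
      simpa using ((hasDerivAt_pow 2 t).const_mul A).const_add (k ^ 2)
    refine (h.sqrt (hP t ht).ne').congr_deriv ?_
    have := Real.sqrt_pos.2 (hP t ht)
    field_simp
  have hz₂ : ∀ t ∈ Set.Ioo (-ε) ε, z₂ t = 1 / √(k ^ 2 + A * t ^ 2) ^ 3 := by
    intro t ht
    have hs := Real.sqrt_pos.2 (hP t ht)
    have hs2 := Real.sq_sqrt (hP t ht).le
    have hq := hz t ht
    have hp := hpos t ht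
    set S := √(k ^ 2 + A * t ^ 2)
    rw [← hs2] at hq
    rw [eq_div_iff (by positivity)]
    have : (z₂ t * S ^ 3) ^ 2 = 1 ^ 2 := by linear_combination hq
    exact (pow_left_inj₀ (by positivity) zero_le_one two_ne_zero).1 this
  have hz₁ : ∀ t ∈ Set.Ioo (-ε) ε, z₁ t = t / (k ^ 2 * √(k ^ 2 + A * t ^ 2)) := by
    refine eq_of_hasDerivAt_eq h₂ (fun t ht => ?_) hmem (by simp [h0'])
    have hs := Real.sqrt_pos.2 (hP t ht)
    have hs2 := Real.sq_sqrt (hP t ht).le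
    refine ((hasDerivAt_id t).div ((hS t ht).const_mul (k ^ 2)) (by positivity)).congr_deriv ?_
    rw [hz₂ t ht]
    set S := √(k ^ 2 + A * t ^ 2)
    simp only [id]
    field_simp
    linear_combination hs2
  -- Writing the primitive with `√(k² + A t²) + k` in the denominator, instead of a difference
  -- divided by `A`, covers the parabola `A = 0` as well.
  have hζ : ∀ t ∈ Set.Ioo (-ε) ε, ζ t = t ^ 2 / (k ^ 2 * (√(k ^ 2 + A * t ^ 2) + k)) := by
    refine eq_of_hasDerivAt_eq h₁ (fun t ht => ?_) hmem (by simp [h0])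
    have hs := Real.sqrt_pos.2 (hP t ht)
    have hs2 := Real.sq_sqrt (hP t ht).le
    refine ((hasDerivAt_pow 2 t).div (((hS t ht).add_const k).const_mul (k ^ 2))
      (by positivity)).congr_deriv ?_
    rw [hz₁ t ht]
    set S := √(k ^ 2 + A * t ^ 2)
    simp only [Nat.cast_ofNat, Nat.add_one_sub_one, pow_one]
    field_simp
    linear_combination t * hs2
  have hs := Real.sqrt_pos.2 (hP t ht)
  have hs2 := Real.sq_sqrt (hP t ht).le
  have hq := hζ t ht
  set S := √(k ^ 2 + A * t ^ 2)
  rw [eq_div_iff (by positivity)] at hq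
  -- Eliminating the square root yields the conic equation multiplied by `t²`, so `t = 0` is treated
  -- apart.
  rcases eq_or_ne t 0 with rfl | hne
  · simp [h0]
  · have : t ^ 2 * (t ^ 2 - (A * k ^ 4 * ζ t ^ 2 + 2 * k ^ 3 * ζ t)) = 0 := by
      linear_combination (-ζ t * k ^ 2 * S + k ^ 3 * ζ t - t ^ 2) * hq + k ^ 4 * ζ t ^ 2 * hs2
    rcases mul_eq_zero.1 this with h | h
    · exact absurd h (by positivity)
    · linarith

/-- A strictly convex even curve all of whose families of parallel chords induce projective
involutions of the pencils of tangent directions is a conic. -/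
theorem even_curve_conic {ζ : ℝ → ℝ} {ε : ℝ} (hε : 0 < ε)
    (hζ : ∀ t ∈ Set.Ioo (-ε) ε, ContDiffAt ℝ 4 ζ t)
    (hpos : ∀ t ∈ Set.Ioo (-ε) ε, 0 < deriv (deriv ζ) t)
    (heven : ∀ t ∈ Set.Ioo (-ε) ε, ζ (-t) = ζ t) (h0 : ζ 0 = 0)
    (hc : ∀ s, ∀ t₁ ∈ Set.Ioo (-ε) ε, ∀ t₂ ∈ Set.Ioo (-ε) ε, t₁ ≠ t₂ →
      ζ t₂ - ζ t₁ = s * (t₂ - t₁) →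
      ∃ c, ∀ t ∈ Set.Ioo (-ε) ε, ∀ X ∈ Set.Ioo (-ε) ε, t ≠ X → ζ X - ζ t = s * (X - t) →
        (deriv ζ X - s) * (1 + c * (deriv ζ t - s)) = -(deriv ζ t - s)) :
    ∃ A B, 0 < B ∧ ∀ t ∈ Set.Ioo (-ε) ε, t ^ 2 = A * ζ t ^ 2 + B * ζ t := by
  set I := Set.Ioo (-ε) ε with hI
  have hmem : (0 : ℝ) ∈ I := ⟨by linarith, hε⟩
  have hC1 : ∀ t ∈ I, ContDiffAt ℝ 3 (deriv ζ) t := fun t ht => (hζ t ht).derivWithin (by norm_num)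
  have hC2 : ∀ t ∈ I, ContDiffAt ℝ 2 (deriv (deriv ζ)) t :=
    fun t ht => (hC1 t ht).derivWithin (by norm_num)
  have h₁ : ∀ t ∈ I, HasDerivAt ζ (deriv ζ t) t :=
    fun t ht => ((hζ t ht).differentiableAt (by norm_num)).hasDerivAt
  have h₂ : ∀ t ∈ I, HasDerivAt (deriv ζ) (deriv (deriv ζ) t) t :=
    fun t ht => ((hC1 t ht).differentiableAt (by norm_num)).hasDerivAt
  have h₃ : ∀ t ∈ I, HasDerivAt (deriv (deriv ζ)) (deriv (deriv (deriv ζ)) t) t :=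
    fun t ht => ((hC2 t ht).differentiableAt (by norm_num)).hasDerivAt
  set P : ℝ → ℝ := fun t => deriv (deriv ζ) t ^ (-2 / 3 : ℝ) with hPdef
  have hCP : ∀ t ∈ I, ContDiffAt ℝ 2 P t :=
    fun t ht => (hC2 t ht).rpow_const_of_ne (hpos t ht).ne'
  have hCP1 : ∀ t ∈ I, ContDiffAt ℝ 1 (deriv P) t :=
    fun t ht => (hCP t ht).derivWithin (by norm_num)
  have hP₁ : ∀ t ∈ I, HasDerivAt P (deriv P t) t :=
    fun t ht => ((hCP t ht).differentiableAt (by norm_num)).hasDerivAt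
  have hP₂ : ∀ t ∈ I, HasDerivAt (deriv P) (deriv (deriv P) t) t :=
    fun t ht => ((hCP1 t ht).differentiableAt (by norm_num)).hasDerivAt
  have hPpos : ∀ t ∈ I, 0 < P t := fun t ht => Real.rpow_pos_of_pos (hpos t ht) _
  have hPz : ∀ t ∈ I, P t ^ 3 * deriv (deriv ζ) t ^ 2 = 1 := by
    intro t ht
    simp only [hPdef]
    rw [← Real.rpow_natCast, ← Real.rpow_natCast, ← Real.rpow_mul (hpos t ht).le,
      ← Real.rpow_add (hpos t ht)]
    norm_num
  have hmono : StrictMonoOn (deriv ζ) I :=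
    strictMonoOn_of_deriv_pos (convex_Ioo _ _) (fun t ht => (h₂ t ht).continuousAt.continuousWithinAt)
      (fun t ht => hpos t (interior_subset ht))
  have hslope : ∀ t₁ ∈ I, ∀ t₂ ∈ I, t₁ < t₂ → ∃ s, ζ t₂ - ζ t₁ = s * (t₂ - t₁) ∧
      deriv ζ t₁ < s ∧ s < deriv ζ t₂ := by
    intro t₁ ht₁ t₂ ht₂ hlt
    have hsub : Set.Icc t₁ t₂ ⊆ I := Set.Icc_subset_Ioo ht₁.1 ht₂.2
    obtain ⟨x, hx, hxs⟩ := exists_deriv_eq_slope ζ hlt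
      (fun t ht => (h₁ t (hsub ht)).continuousAt.continuousWithinAt)
      (fun t ht => (h₁ t (hsub (Set.Ioo_subset_Icc_self ht))).differentiableAt.differentiableWithinAt)
    have hxI := hsub (Set.Ioo_subset_Icc_self hx)
    refine ⟨deriv ζ x, ?_, hmono ht₁ hxI hx.1, hmono hxI ht₂ hx.2⟩
    rw [hxs, div_mul_cancel₀ _ (sub_pos.2 hlt).ne']
  -- Any two points of the graph are the ends of a chord, and strict convexity makes that chord
  -- transversal at both.
  have hconst' : ∀ t₁ ∈ I, ∀ t₂ ∈ I, t₁ < t₂ → deriv (deriv P) t₁ = deriv (deriv P) t₂ := by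
    intro t₁ ht₁ t₂ ht₂ hlt
    obtain ⟨s, hs, hs1, hs2⟩ := hslope t₁ ht₁ t₂ ht₂ hlt
    obtain ⟨c, hc'⟩ := hc s t₁ ht₁ t₂ ht₂ hlt.ne hs
    exact affine_curvature_eq isOpen_Ioo (fun t ht => (hζ t ht).of_le (by norm_num)) h₁ h₂ h₃ hpos
      hPpos hPz hP₁ hP₂ ht₁ ht₂ hlt.ne hs hs1.ne hs2.ne' hc'
  have hconst : ∀ t ∈ I, deriv (deriv P) t = deriv (deriv P) 0 := by
    intro t ht
    rcases lt_trichotomy t 0 with h | h | h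
    · exact hconst' t ht 0 hmem h
    · rw [h]
    · exact (hconst' 0 hmem t ht h).symm
  have hodd : ∀ {f : ℝ → ℝ} {f' : ℝ}, (∀ t ∈ I, f (-t) = f t) → HasDerivAt f f' 0 → f' = 0 := by
    intro f f' hf hd
    have e1 : HasDerivAt (fun t => f (-t)) (-f') 0 := by
      have hd' : HasDerivAt f f' (-0) := by simpa using hd
      simpa [Function.comp_def] using hd'.comp 0 (hasDerivAt_neg (0 : ℝ))
    have e2 : HasDerivAt (fun t => f (-t)) f' 0 :=
      hd.congr_of_eventuallyEq (by filter_upwards [isOpen_Ioo.mem_nhds hmem] with t ht using hf t ht)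
    linarith [e1.unique e2]
  have hneg : ∀ t ∈ I, -t ∈ I := fun t ht => ⟨by linarith [ht.2], by linarith [ht.1]⟩
  have hz1odd : ∀ t ∈ I, deriv ζ (-t) = -deriv ζ t := by
    intro t ht
    have : deriv (fun x => ζ (-x)) t = deriv ζ t :=
      EventuallyEq.deriv_eq (by filter_upwards [isOpen_Ioo.mem_nhds ht] with x hx using heven x hx)
    rw [deriv_comp_neg] at this
    linarith
  have hz2even : ∀ t ∈ I, deriv (deriv ζ) (-t) = deriv (deriv ζ) t := by
    intro t ht
    have : deriv (fun x => deriv ζ (-x)) t = deriv (fun x => -deriv ζ x) t :=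
      EventuallyEq.deriv_eq (by filter_upwards [isOpen_Ioo.mem_nhds ht] with x hx using hz1odd x hx)
    rw [deriv_comp_neg, deriv.fun_neg] at this
    linarith
  have hPeven : ∀ t ∈ I, P (-t) = P t := fun t ht => by simp only [hPdef, hz2even t ht]
  have hP10 : deriv P 0 = 0 := hodd hPeven (hP₁ 0 hmem)
  have hz10 : deriv ζ 0 = 0 := hodd heven (h₁ 0 hmem)
  -- As `P` is even with constant second derivative, it equals `P 0 + A t²`; the `k` of
  -- `conic_of_second_deriv` is `√(P 0)`.
  set A := deriv (deriv P) 0 / 2 with hA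
  have hP1 : ∀ t ∈ I, deriv P t = 2 * A * t := by
    refine eq_of_hasDerivAt_eq hP₂ (fun t ht => ?_) hmem (by simp [hP10])
    rw [hconst t ht]
    simpa [hA, mul_div_cancel₀] using (hasDerivAt_id t).const_mul (2 * A)
  have hPf : ∀ t ∈ I, P t = P 0 + A * t ^ 2 := by
    refine eq_of_hasDerivAt_eq hP₁ (fun t ht => ?_) hmem (by simp)
    refine (((hasDerivAt_pow 2 t).const_mul A).const_add (P 0)).congr_deriv ?_
    rw [hP1 t ht]
    simp
    ring
  have hk : 0 < √(P 0) := Real.sqrt_pos.2 (hPpos 0 hmem)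
  have hk2 : √(P 0) ^ 2 = P 0 := Real.sq_sqrt (hPpos 0 hmem).le
  refine ⟨A * √(P 0) ^ 4, 2 * √(P 0) ^ 3, by positivity, fun t ht => ?_⟩
  refine conic_of_second_deriv hε hk h₁ h₂ hpos (fun t ht => ?_) (fun t ht => ?_) h0 hz10 ht
  · rw [hk2, ← hPf t ht]; exact hPpos t ht
  · rw [hk2, ← hPf t ht]; exact hPz t ht

variable {E : Type*} [NormedAddCommGroup E] [InnerProductSpace ℝ E]

/-! ### Projective involutions fixing a hyperplane pointwise -/

section LinearAlgebra

/-- A linear map for which all vectors of an open subset of a hyperplane are eigenvectors is scalar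
on the hyperplane. -/
theorem exists_scalar_of_eigenvectors {M : E →ₗ[ℝ] E} {v ξ : E} {ε : ℝ} (hε : 0 < ε) (hξ : ξ ≠ 0)
    (hξv : inner ℝ ξ v = 0)
    (h : ∀ η : E, inner ℝ η v = 0 → ‖η - ξ‖ < ε → ∃ c : ℝ, M η = c • η) :
    ∃ l : ℝ, ∀ y : E, inner ℝ y v = 0 → M y = l • y := by
  obtain ⟨l, hl⟩ := h ξ hξv (by simpa using hε)
  refine ⟨l, fun y hy => ?_⟩
  by_cases hdep : ∃ c : ℝ, y = c • ξ
  · obtain ⟨c, rfl⟩ := hdep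
    rw [map_smul, hl, smul_comm]
  have hy0 : y ≠ 0 := by
    rintro rfl
    exact hdep ⟨0, by simp⟩
  have hny : 0 < ‖y‖ := norm_pos_iff.2 hy0
  set s : ℝ := ε / (2 * ‖y‖) with hs
  have hs0 : 0 < s := by positivity
  have hsn : ‖s • y‖ < ε := by
    rw [norm_smul, Real.norm_of_nonneg hs0.le, hs]
    field_simp
    norm_num
  obtain ⟨a, ha⟩ := h (ξ + s • y) (by simp [inner_add_left, inner_smul_left, hξv, hy])
    (by simpa using hsn)
  obtain ⟨b, hb⟩ := h (ξ - s • y) (by simp [inner_sub_left, inner_smul_left, hξv, hy])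
    (by simpa using hsn)
  rw [map_add, map_smul, hl] at ha
  rw [map_sub, map_smul, hl] at hb
  -- Adding the eigenvector equations at `ξ + s y` and `ξ - s y` cancels `M y`; independence of `ξ`
  -- and `y` then equates the eigenvalues.
  have hsum : (2 * l - a - b) • ξ = ((a - b) * s) • y := by
    have h2 := congrArg₂ (· + ·) ha hb
    rw [← sub_eq_zero] at h2 ⊢
    rw [← h2]
    module
  have hab : a = b := by
    by_contra hab
    refine hdep ⟨((a - b) * s)⁻¹ * (2 * l - a - b), ?_⟩
    rw [mul_smul, hsum, smul_smul, inv_mul_cancel₀, one_smul]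
    exact mul_ne_zero (sub_ne_zero.2 hab) hs0.ne'
  subst hab
  have hla : l = a := by
    have : (2 * l - a - a) • ξ = 0 := by rw [hsum]; simp
    rcases smul_eq_zero.1 this with h0 | h0
    · linarith
    · exact absurd h0 hξ
  subst hla
  have : s • (M y - l • y) = 0 := by
    rw [← sub_eq_zero] at ha
    rw [← ha]
    module
  rcases smul_eq_zero.1 this with h0 | h0
  · exact absurd h0 hs0.ne'
  · exact sub_eq_zero.1 h0

/-- A projective involution fixing the points of a hyperplane is the identity or a harmonic
homology. -/
theorem scalar_or_homology {M : E →ₗ[ℝ] E} {v ξ : E} {l : ℝ} (hM : Function.Injective M)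
    (hMM : ∀ x, ∃ c : ℝ, M (M x) = c • x) (hv : v ≠ 0) (hξ : ξ ≠ 0) (hξv : inner ℝ ξ v = 0)
    (hl : ∀ y : E, inner ℝ y v = 0 → M y = l • y) :
    (∀ x, M x = l • x) ∨
      ∃ w : E, inner ℝ w v = 2 ∧ ∀ x, M x = l • (x - (inner ℝ x v : ℝ) • w) := by
  have hvv : (inner ℝ v v : ℝ) ≠ 0 := inner_self_ne_zero.2 hv
  have hvξ : (inner ℝ v ξ : ℝ) = 0 := by rw [real_inner_comm]; exact hξv
  have hl0 : l ≠ 0 := by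
    rintro rfl
    exact hξ (hM (by rw [hl ξ hξv, map_zero, zero_smul]))
  have hdec : ∀ x, M x = l • x + (inner ℝ x v / inner ℝ v v : ℝ) • (M v - l • v) := by
    intro x
    have h1 : inner ℝ (x - (inner ℝ x v / inner ℝ v v : ℝ) • v) v = 0 := by
      rw [inner_sub_left, real_inner_smul_left, div_mul_cancel₀ _ hvv, sub_self]
    have h2 := hl _ h1
    rw [map_sub, map_smul, sub_eq_iff_eq_add] at h2
    rw [h2]
    module
  set σ : ℝ := inner ℝ (M v) v / inner ℝ v v with hσ
  set y := M v - σ • v with hy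
  have hyv : inner ℝ y v = 0 := by
    rw [hy, inner_sub_left, real_inner_smul_left, hσ, div_mul_cancel₀ _ hvv, sub_self]
  have hvy : (inner ℝ v y : ℝ) = 0 := by rw [real_inner_comm]; exact hyv
  have hMv : M v = σ • v + y := by rw [hy]; abel
  have hMMv : M (M v) = (σ ^ 2) • v + (σ + l) • y := by
    rw [hMv, map_add, map_smul, hl y hyv, hMv]
    module
  obtain ⟨c, hc⟩ := hMM v
  have e0 := hMMv.symm.trans hc
  have e1 : (σ + l) * inner ℝ y y = 0 := by
    have := congrArg (fun z => (inner ℝ z y : ℝ)) e0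
    simpa [inner_add_left, real_inner_smul_left, hvy] using this
  have e2 : σ ^ 2 = c := by
    have := congrArg (fun z => (inner ℝ z v : ℝ)) e0
    simpa [inner_add_left, real_inner_smul_left, hyv, hv] using this
  -- The factor by which `M²` scales a vector may depend on the vector; testing `v + ξ` shows that
  -- it is `l²` on `v` too, so `σ = ± l`.
  obtain ⟨c', hc'⟩ := hMM (v + ξ)
  have e3 : c • v + (l * l) • ξ = c' • v + c' • ξ := by
    rw [← smul_add, ← hc', map_add, map_add, hc, hl ξ hξv, map_smul, hl ξ hξv, smul_smul]
  have e4 : c = c' := by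
    have := congrArg (fun z => (inner ℝ z v : ℝ)) e3
    simpa [inner_add_left, real_inner_smul_left, hξv, hv] using this
  have e5 : l * l = c' := by
    have := congrArg (fun z => (inner ℝ z ξ : ℝ)) e3
    simpa [inner_add_left, real_inner_smul_left, hvξ, hξ] using this
  have e6 : (σ - l) * (σ + l) = 0 := by
    have : σ ^ 2 = l * l := by rw [e2, e4, e5]
    linear_combination this
  rcases mul_eq_zero.1 e6 with h | h
  · left
    have hσl : σ = l := sub_eq_zero.1 h
    have hy0 : y = 0 := by
      rcases mul_eq_zero.1 e1 with h' | h'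
      · exact absurd (by linarith : l = 0) hl0
      · exact inner_self_eq_zero.1 h'
    intro x
    rw [hdec x, hMv, hy0, hσl]
    simp
  · right
    have hσl : σ = -l := by linarith
    -- For `σ = -l` this vector spans the eigenline of `M` with eigenvalue `-l`, the centre of the
    -- homology.
    refine ⟨(l * inner ℝ v v)⁻¹ • (l • v - M v), ?_, fun x => ?_⟩
    · rw [real_inner_smul_left, hMv, inner_sub_left, inner_add_left, real_inner_smul_left,
        real_inner_smul_left, hyv, hσl]
      field_simp
      ring
    · rw [hdec x, smul_sub l x, smul_smul _ _ (l • v - M v), smul_smul l _ (l • v - M v),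
        show l * (inner ℝ x v * (l * inner ℝ v v)⁻¹) = (inner ℝ x v / inner ℝ v v : ℝ) by
          field_simp]
      module

end LinearAlgebra

/-! ### Uniformly convex patches and the homologies acting on their normals -/

/-- The hypersurface `f = 0` near `O`, with `f` uniformly strictly convex in the ball of radius `r`
about `O`. -/
structure ConvexPatch (f : E → ℝ) (O : E) (r μ : ℝ) : Prop where
  r_pos : 0 < r
  μ_pos : 0 < μ
  contDiffAt : ∀ x ∈ Metric.ball O r, ContDiffAt ℝ 6 f x
  map_base : f O = 0
  fderiv_ne : fderiv ℝ f O ≠ 0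
  hess_pos : ∀ v ≠ 0, 0 < fderiv ℝ (fderiv ℝ f) O v v
  convex : ∀ p ∈ Metric.ball O r, ∀ q ∈ Metric.ball O r,
    f p + fderiv ℝ f p (q - p) + μ / 2 * ‖q - p‖ ^ 2 ≤ f q

/-- Every family of parallel chords of `f = 0` in the ball induces a projective involution on the
normals. -/
def HasProjectiveChords [CompleteSpace E] (f : E → ℝ) (O : E) (r : ℝ) : Prop :=
  ∀ v : E, v ≠ 0 →
    (∃ A ∈ Metric.ball O r, ∃ B ∈ Metric.ball O r, f A = 0 ∧ f B = 0 ∧ A ≠ B ∧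
      ∃ t : ℝ, B = A + t • v) →
    ∃ M : E →ₗ[ℝ] E, Function.Injective M ∧ (∀ x, ∃ c : ℝ, M (M x) = c • x) ∧
      ∀ A ∈ Metric.ball O r, ∀ B ∈ Metric.ball O r, f A = 0 → f B = 0 →
        (∃ t : ℝ, B = A + t • v) → (A ≠ B ∨ (A = B ∧ fderiv ℝ f A v = 0)) →
        ∃ c : ℝ, M (gradient f A) = c • gradient f B

namespace ConvexPatch

variable {f : E → ℝ} {O : E} {r μ : ℝ}

theorem inner_gradient [CompleteSpace E] (f : E → ℝ) (x v : E) : inner ℝ (gradient f x) v = fderiv ℝ f x v := by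
  simp [gradient]

theorem base_mem (h : ConvexPatch f O r μ) : O ∈ Metric.ball O r := Metric.mem_ball_self h.r_pos

theorem differentiableAt (h : ConvexPatch f O r μ) {x : E} (hx : x ∈ Metric.ball O r) :
    DifferentiableAt ℝ f x := (h.contDiffAt x hx).differentiableAt (by norm_num)

theorem base_ineq (h : ConvexPatch f O r μ) {p : E} (hp : p ∈ Metric.ball O r) :
    fderiv ℝ f O (p - O) + μ / 2 * ‖p - O‖ ^ 2 ≤ f p := by
  simpa [h.map_base] using h.convex O h.base_mem p hp

/-- Uniform convexity makes the differential at a zero of `f` strictly negative towards any other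
point of the sublevel set. Applied at both ends of a chord, it gives derivatives of opposite sign
along a common direction. -/
theorem fderiv_chord_neg (h : ConvexPatch f O r μ) {p q : E} (hp : p ∈ Metric.ball O r)
    (hq : q ∈ Metric.ball O r) (hfp : f p = 0) (hfq : f q ≤ 0) (hne : p ≠ q) :
    fderiv ℝ f p (q - p) < 0 := by
  have h1 := h.convex p hp q hq
  have h2 : 0 < ‖q - p‖ := norm_pos_iff.2 (sub_ne_zero.2 hne.symm)
  have h3 : 0 < μ / 2 * ‖q - p‖ ^ 2 := by have := h.μ_pos; positivity
  linarith

theorem fderiv_ne_zero (h : ConvexPatch f O r μ) {p : E} (hp : p ∈ Metric.ball O r)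
    (hfp : f p = 0) : fderiv ℝ f p ≠ 0 := by
  intro h0
  rcases eq_or_ne p O with rfl | hne
  · exact h.fderiv_ne h0
  · have := h.fderiv_chord_neg hp h.base_mem hfp h.map_base.le hne
    simp [h0] at this

/-- Each vector near the gradient at the base point is normal to the patch. -/
theorem exists_normal [CompleteSpace E] [FiniteDimensional ℝ E] (h : ConvexPatch f O r μ) :
    ∃ ε > 0, ∀ ξ : E, ‖ξ - gradient f O‖ < ε →
      ∃ A ∈ Metric.ball O r, f A = 0 ∧ ∃ c : ℝ, ξ = c • gradient f A := by
  have hμ := h.μ_pos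
  have hr := h.r_pos
  have hg : 0 < ‖gradient f O‖ := by
    rw [norm_pos_iff]
    intro h0
    refine h.fderiv_ne (ContinuousLinearMap.ext fun x => ?_)
    rw [← inner_gradient, h0, inner_zero_left]
    rfl
  -- The first bound keeps `ξ` nonzero; the second keeps the maximum point of `⟪ξ, ·⟫` on the
  -- sublevel set within distance `r / 4` of `O`, away from the sphere of radius `r / 2`.
  refine ⟨min ‖gradient f O‖ (μ * r / 8), lt_min hg (by positivity), fun ξ hξ => ?_⟩
  have hξ1 := hξ.trans_le (min_le_left _ _)
  have hξ2 := hξ.trans_le (min_le_right _ _)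
  have hξ0 : ξ ≠ 0 := by
    rintro rfl
    simp at hξ1
  have hsub : Metric.closedBall O (r / 2) ⊆ Metric.ball O r :=
    Metric.closedBall_subset_ball (by linarith)
  set K := Metric.closedBall O (r / 2) ∩ f ⁻¹' Set.Iic 0 with hK
  have hcont : ContinuousOn f (Metric.closedBall O (r / 2)) := fun x hx =>
    (h.differentiableAt (hsub hx)).continuousAt.continuousWithinAt
  have hKc : IsCompact K :=
    (isCompact_closedBall O (r / 2)).of_isClosed_subset
      (hcont.preimage_isClosed_of_isClosed Metric.isClosed_closedBall isClosed_Iic)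
      Set.inter_subset_left
  have hOK : O ∈ K := ⟨Metric.mem_closedBall_self (by linarith), h.map_base.le⟩
  -- `A` is a support point in direction `ξ`; being interior to the closed ball, it lies on `f = 0`,
  -- and Lagrange multipliers make `ξ` normal there.
  obtain ⟨A, hAK, hmax⟩ := hKc.exists_isMaxOn ⟨O, hOK⟩
    (f := fun x => (inner ℝ ξ x : ℝ)) (by fun_prop)
  have hAr : A ∈ Metric.ball O r := hsub hAK.1
  have hAO : (inner ℝ ξ O : ℝ) ≤ inner ℝ ξ A := hmax hOK
  have hd : ‖A - O‖ < r / 2 := by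
    have h1 := h.base_ineq hAr
    rw [← inner_gradient] at h1
    have h2 : (inner ℝ (ξ - gradient f O) (A - O) : ℝ) ≤ ‖ξ - gradient f O‖ * ‖A - O‖ :=
      real_inner_le_norm _ _
    have h3 : (0 : ℝ) ≤ inner ℝ ξ (A - O) := by rw [inner_sub_right]; linarith
    rw [inner_sub_left] at h2
    have h4 : f A ≤ 0 := hAK.2
    by_contra hcon
    rw [not_lt] at hcon
    have h5 : ‖ξ - gradient f O‖ * ‖A - O‖ ≤ μ * r / 8 * ‖A - O‖ :=
      mul_le_mul_of_nonneg_right hξ2.le (norm_nonneg _)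
    have h6 : μ / 2 * ‖A - O‖ ^ 2 ≤ μ * r / 8 * ‖A - O‖ := by linarith
    have h7 : μ * r / 4 * ‖A - O‖ ≤ μ / 2 * ‖A - O‖ ^ 2 := by
      have := mul_le_mul_of_nonneg_left hcon (by positivity : 0 ≤ μ / 2 * ‖A - O‖)
      nlinarith
    have h8 : 0 < μ * r * ‖A - O‖ := by
      have : 0 < ‖A - O‖ := by linarith
      positivity
    linarith
  have hnhds : Metric.closedBall O (r / 2) ∈ 𝓝 A :=
    mem_of_superset (Metric.isOpen_ball.mem_nhds (by rwa [Metric.mem_ball, dist_eq_norm]))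
      Metric.ball_subset_closedBall
  have hstrict : HasStrictFDerivAt (fun x => (inner ℝ ξ x : ℝ)) (innerSL ℝ ξ) A :=
    (innerSL ℝ ξ).hasStrictFDerivAt
  have hfA : f A = 0 := by
    refine le_antisymm hAK.2 ?_
    by_contra hlt
    rw [not_le] at hlt
    have hloc : IsLocalMax (fun x => (inner ℝ ξ x : ℝ)) A := by
      filter_upwards [hnhds, (h.differentiableAt hAr).continuousAt.eventually_lt
        continuousAt_const hlt] with x hx hx' using hmax ⟨hx, hx'.le⟩
    have := hloc.hasFDerivAt_eq_zero hstrict.hasFDerivAt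
    have h2 := congrArg (fun L : E →L[ℝ] ℝ => L ξ) this
    simp only [innerSL_apply_apply, _root_.zero_apply] at h2
    exact hξ0 (inner_self_eq_zero.1 h2)
  have hext : IsLocalExtrOn (fun x => (inner ℝ ξ x : ℝ)) {x | f x = f A} A := by
    right
    filter_upwards [mem_nhdsWithin_of_mem_nhds hnhds, self_mem_nhdsWithin] with x hx hx'
    exact hmax ⟨hx, (hx'.trans hfA).le⟩
  obtain ⟨a, b, hab, hlin⟩ := hext.exists_multipliers_of_hasStrictFDerivAt_1d
    ((h.contDiffAt A hAr).hasStrictFDerivAt (by norm_num)) hstrict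
  have hb : b ≠ 0 := by
    rintro rfl
    rw [zero_smul, add_zero] at hlin
    rcases smul_eq_zero.1 hlin with h0 | h0
    · exact hab (by rw [h0]; rfl)
    · exact h.fderiv_ne_zero hAr hfA h0
  refine ⟨A, hAr, hfA, -(b⁻¹ * a), ext_inner_right ℝ fun x => ?_⟩
  have := congrArg (fun L : E →L[ℝ] ℝ => L x) hlin
  simp only [_root_.add_apply, _root_.smul_apply, smul_eq_mul,
    innerSL_apply_apply, _root_.zero_apply] at this
  rw [real_inner_smul_left, inner_gradient]
  field_simp
  linarith

/-- The harmonic homologies of the normals, in terms of differentials. The functional `ω`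
annihilates the mirror of the affine reflection exchanging the endpoints of the chords. -/
theorem exists_homology [CompleteSpace E] [FiniteDimensional ℝ E] (h : ConvexPatch f O r μ)
    (hproj : HasProjectiveChords f O r) :
    ∃ r₁ > 0, r₁ ≤ r ∧ (∀ x ∈ Metric.ball O r₁, 0 < inner ℝ (gradient f x) (gradient f O)) ∧
      ∀ v : E, v ≠ 0 →
        (∃ A ∈ Metric.ball O r₁, ∃ B ∈ Metric.ball O r₁, f A = 0 ∧ f B = 0 ∧ A ≠ B ∧
          ∃ t : ℝ, B = A + t • v) →
        ∃ ω : E →L[ℝ] ℝ, ω v = 1 ∧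
          ∀ A ∈ Metric.ball O r₁, ∀ B ∈ Metric.ball O r₁, f A = 0 → f B = 0 → A ≠ B →
            (∃ t : ℝ, B = A + t • v) → ∃ k : ℝ,
              ∀ x, fderiv ℝ f B x = k * (fderiv ℝ f A x - 2 * fderiv ℝ f A v * ω x) := by
  obtain ⟨ε, hε, hnormal⟩ := h.exists_normal
  have hgO : gradient f O ≠ 0 := by
    intro h0
    refine h.fderiv_ne (ContinuousLinearMap.ext fun x => ?_)
    rw [← inner_gradient, h0, inner_zero_left]
    rfl
  have hgc : ContinuousAt (gradient f) O := by
    have h1 : ContinuousAt (fderiv ℝ f) O :=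
      (h.contDiffAt O h.base_mem).continuousAt_fderiv (by norm_num)
    exact (InnerProductSpace.toDual ℝ E).symm.continuous.continuousAt.comp h1
  have hev : ∀ᶠ x in 𝓝 O, ‖gradient f x - gradient f O‖ < ε ∧
      0 < (inner ℝ (gradient f x) (gradient f O) : ℝ) := by
    refine Filter.Eventually.and ?_ ?_
    · have : Tendsto (fun x => ‖gradient f x - gradient f O‖) (𝓝 O) (𝓝 0) := by
        have h1 : ContinuousAt (fun x => ‖gradient f x - gradient f O‖) O :=
          (hgc.sub continuousAt_const).norm
        simpa using h1.tendsto
      exact this.eventually_lt_const hε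
    · have : Tendsto (fun x => (inner ℝ (gradient f x) (gradient f O) : ℝ)) (𝓝 O)
          (𝓝 (inner ℝ (gradient f O) (gradient f O))) :=
        hgc.inner continuousAt_const
      exact this.eventually_const_lt (real_inner_self_pos.2 hgO)
  -- In the smaller ball all gradients lie in the open set of realized normals and in one open
  -- half-space.
  obtain ⟨r₀, hr₀, hr₀'⟩ := Metric.eventually_nhds_iff_ball.1 hev
  have hsub : Metric.ball O (min r₀ r) ⊆ Metric.ball O r := Metric.ball_subset_ball (min_le_right _ _)
  have hsub₀ : Metric.ball O (min r₀ r) ⊆ Metric.ball O r₀ := Metric.ball_subset_ball (min_le_left _ _)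
  refine ⟨min r₀ r, lt_min hr₀ h.r_pos, min_le_right _ _, fun x hx => (hr₀' x (hsub₀ hx)).2,
    fun v hv hchord => ?_⟩
  obtain ⟨A, hA, B, hB, hfA, hfB, hAB, t, ht⟩ := hchord
  obtain ⟨M, hM, hMM, hMc⟩ := hproj v hv ⟨A, hsub hA, B, hsub hB, hfA, hfB, hAB, t, ht⟩
  have ht0 : t ≠ 0 := by
    rintro rfl
    exact hAB (by rw [ht]; simp)
  have hBA : B - A = t • v := by rw [ht]; abel
  -- a normal orthogonal to `v`, from the mean value theorem
  obtain ⟨y, hy, hyv⟩ : ∃ y ∈ Metric.ball O (min r₀ r), fderiv ℝ f y v = 0 := by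
    obtain ⟨y, hy, hyd⟩ := domain_mvt (f := f) (f' := fun x => fderiv ℝ f x)
      (s := Metric.ball O (min r₀ r))
      (fun x hx => (h.differentiableAt (hsub hx)).hasFDerivAt.hasFDerivWithinAt)
      (convex_ball _ _) hA hB
    refine ⟨y, (convex_ball O _).segment_subset hA hB hy, ?_⟩
    rw [hfA, hfB, hBA, map_smul, smul_eq_mul, sub_self, eq_comm] at hyd
    exact (mul_eq_zero.1 hyd).resolve_left ht0
  have hyb := hr₀' y (hsub₀ hy)
  set ξ := gradient f y with hξ
  have hξv : inner ℝ ξ v = 0 := by rw [hξ, inner_gradient, hyv]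
  have hξ0 : ξ ≠ 0 := by
    intro h0
    have := hyb.2
    rw [h0, inner_zero_left] at this
    exact lt_irrefl _ this
  -- A vector of `v^⊥` near `ξ` is normal to the patch at some `T`. The line through `T` parallel to
  -- `v` is tangent there, so `T` is its own partner and the vector is an eigenvector of `M`.
  obtain ⟨l, hl⟩ := exists_scalar_of_eigenvectors (M := M) (sub_pos.2 hyb.1) hξ0 hξv
    (fun η hη hηξ => by
      obtain ⟨T, hT, hfT, c, hc⟩ := hnormal η (by
        calc ‖η - gradient f O‖ = ‖(η - ξ) + (ξ - gradient f O)‖ := by congr 1; abel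
          _ ≤ ‖η - ξ‖ + ‖ξ - gradient f O‖ := norm_add_le _ _
          _ < ε := by linarith)
      by_cases hc0 : c = 0
      · exact ⟨0, by rw [hc, hc0]; simp⟩
      have hTv : fderiv ℝ f T v = 0 := by
        rw [hc, real_inner_smul_left, inner_gradient] at hη
        exact (mul_eq_zero.1 hη).resolve_left hc0
      obtain ⟨d, hd⟩ := hMc T hT T hT hfT hfT ⟨0, by simp⟩ (Or.inr ⟨rfl, hTv⟩)
      exact ⟨d, by rw [hc, map_smul, hd, smul_comm]⟩)
  rcases scalar_or_homology hM hMM hv hξ0 hξv hl with hs | ⟨w, hw, hMw⟩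
  -- A scalar `M` would make the gradients at `A` and `B` proportional; pairing with `B - A` gives a
  -- negative ratio, pairing with the gradient at `O` a positive one.
  · exfalso
    have hl0 : l ≠ 0 := by
      rintro rfl
      exact hξ0 (hM (by rw [hs ξ, map_zero, zero_smul]))
    obtain ⟨c, hc⟩ := hMc A (hsub hA) B (hsub hB) hfA hfB ⟨t, ht⟩ (Or.inl hAB)
    rw [hs] at hc
    have h1 := h.fderiv_chord_neg (hsub hA) (hsub hB) hfA hfB.le hAB
    have h2 := h.fderiv_chord_neg (hsub hB) (hsub hA) hfB hfA.le hAB.symm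
    rw [← neg_sub B A, map_neg] at h2
    rw [← inner_gradient] at h1 h2
    have e1 := congrArg (fun z => (inner ℝ z (B - A) : ℝ)) hc
    have e2 := congrArg (fun z => (inner ℝ z (gradient f O) : ℝ)) hc
    simp only [real_inner_smul_left] at e1 e2
    have p1 := (hr₀' A (hsub₀ hA)).2
    have p2 := (hr₀' B (hsub₀ hB)).2
    have q1 : l * c ≤ 0 := by
      by_contra hcon
      rw [not_le] at hcon
      have : l * c * (inner ℝ (gradient f B) (B - A)) = l ^ 2 * inner ℝ (gradient f A) (B - A) := by
        linear_combination -l * e1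
      have i1 : 0 < l * c * (inner ℝ (gradient f B) (B - A) : ℝ) := mul_pos hcon (by linarith)
      have i2 : l ^ 2 * (inner ℝ (gradient f A) (B - A) : ℝ) < 0 :=
        mul_neg_of_pos_of_neg (by positivity) h1
      linarith
    have : l * c * (inner ℝ (gradient f B) (gradient f O)) =
        l ^ 2 * inner ℝ (gradient f A) (gradient f O) := by
      linear_combination -l * e2
    have i1 : l * c * (inner ℝ (gradient f B) (gradient f O) : ℝ) ≤ 0 :=
      mul_nonpos_of_nonpos_of_nonneg q1 p2.le
    have i2 : 0 < l ^ 2 * (inner ℝ (gradient f A) (gradient f O) : ℝ) := by positivity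
    linarith
  · have hω : ∀ x, innerSL ℝ ((1 / 2 : ℝ) • w) x = 1 / 2 * inner ℝ w x := fun x => by
      rw [innerSL_apply_apply, real_inner_smul_left]
    refine ⟨innerSL ℝ ((1 / 2 : ℝ) • w), by rw [hω, hw]; norm_num,
      fun A' hA' B' hB' hfA' hfB' hAB' hpar => ?_⟩
    obtain ⟨c, hc⟩ := hMc A' (hsub hA') B' (hsub hB') hfA' hfB' hpar (Or.inl hAB')
    have hc0 : c ≠ 0 := by
      rintro rfl
      have h0 : gradient f A' = 0 := hM (by rw [hc, map_zero, zero_smul])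
      have := (hr₀' A' (hsub₀ hA')).2
      rw [h0, inner_zero_left] at this
      exact lt_irrefl _ this
    refine ⟨l / c, fun x => ?_⟩
    rw [hMw] at hc
    have e1 := congrArg (fun z => (inner ℝ z x : ℝ)) hc
    simp only [real_inner_smul_left, inner_sub_left, inner_gradient] at e1
    rw [hω]
    field_simp
    linear_combination -e1

end ConvexPatch

/-! ### Chords in tangent directions and affine reflections of the cap -/

/-- The functional `ω` defines the homology of normals induced by the chords parallel to `v`. -/
def IsHomologyFor (f : E → ℝ) (O : E) (r : ℝ) (v : E) (ω : E →L[ℝ] ℝ) : Prop :=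
  ω v = 1 ∧ ∀ A ∈ Metric.ball O r, ∀ B ∈ Metric.ball O r, f A = 0 → f B = 0 → A ≠ B →
    (∃ t : ℝ, B = A + t • v) → ∃ k : ℝ,
      ∀ x, fderiv ℝ f B x = k * (fderiv ℝ f A x - 2 * fderiv ℝ f A v * ω x)

/-- Every family of parallel chords of `f = 0` in the ball induces a homology of normals. -/
def HasHomologies (f : E → ℝ) (O : E) (r : ℝ) : Prop :=
  ∀ v : E, v ≠ 0 →
    (∃ A ∈ Metric.ball O r, ∃ B ∈ Metric.ball O r, f A = 0 ∧ f B = 0 ∧ A ≠ B ∧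
      ∃ t : ℝ, B = A + t • v) → ∃ ω, IsHomologyFor f O r v ω

/-- The part of the hypersurface cut off by a hyperplane parallel to the tangent hyperplane at the
base point. -/
def cap (f : E → ℝ) (O : E) (r μ : ℝ) : Set E :=
  {p | p ∈ Metric.ball O r ∧ f p = 0 ∧ -(μ * r ^ 2 / 8) < fderiv ℝ f O (p - O)}

theorem eventually_neg_of_fderiv_neg {f : E → ℝ} {A d : E} (hf : DifferentiableAt ℝ f A)
    (hA : f A = 0) (hd : fderiv ℝ f A d < 0) : ∀ᶠ s in 𝓝[>] (0 : ℝ), f (A + s • d) < 0 := by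
  have h1 : HasDerivAt (fun s : ℝ => f (A + s • d)) (fderiv ℝ f A d) 0 :=
    hf.hasFDerivAt.hasLineDerivAt d
  have h2 := (hasDerivAt_iff_tendsto_slope_zero.1 h1).eventually_lt_const hd
  have h3 : 𝓝[>] (0 : ℝ) ≤ 𝓝[≠] 0 := nhdsWithin_mono _ fun x hx => ne_of_gt hx
  filter_upwards [h3 h2, self_mem_nhdsWithin] with s hs hs0
  have hs0' : (0 : ℝ) < s := hs0
  simp only [zero_add, zero_smul, add_zero, hA, sub_zero, smul_eq_mul] at hs
  by_contra hcon
  rw [not_lt] at hcon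
  have : 0 ≤ s⁻¹ * f (A + s • d) := by positivity
  linarith

namespace ConvexPatch

variable {f : E → ℝ} {O : E} {r μ : ℝ}

theorem mono {r₁ : ℝ} (h : ConvexPatch f O r μ) (h₁ : 0 < r₁) (hr : r₁ ≤ r) :
    ConvexPatch f O r₁ μ where
  r_pos := h₁
  μ_pos := h.μ_pos
  contDiffAt x hx := h.contDiffAt x (Metric.ball_subset_ball hr hx)
  map_base := h.map_base
  fderiv_ne := h.fderiv_ne
  hess_pos := h.hess_pos
  convex p hp q hq := h.convex p (Metric.ball_subset_ball hr hp) q (Metric.ball_subset_ball hr hq)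

theorem sq_norm_le (h : ConvexPatch f O r μ) {p : E} (hp : p ∈ Metric.ball O r) (hfp : f p ≤ 0) :
    ‖p - O‖ ^ 2 ≤ -(2 / μ) * fderiv ℝ f O (p - O) := by
  have h1 := h.base_ineq hp
  have hμ := h.μ_pos
  have h2 : μ / 2 * ‖p - O‖ ^ 2 ≤ -fderiv ℝ f O (p - O) := by linarith
  have h3 : ‖p - O‖ ^ 2 = (2 / μ) * (μ / 2 * ‖p - O‖ ^ 2) := by field_simp
  rw [h3, neg_mul, ← mul_neg]
  exact mul_le_mul_of_nonneg_left h2 (by positivity)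

/-- Explains the height `μ r² / 8` in `cap`: the bound of `sq_norm_le` becomes `(r / 2)²`, so
horizontal sections of the sublevel set stay well inside the ball. -/
theorem norm_lt (h : ConvexPatch f O r μ) {p : E} (hp : p ∈ Metric.ball O r) (hfp : f p ≤ 0)
    (hh : -(μ * r ^ 2 / 8) < fderiv ℝ f O (p - O)) : ‖p - O‖ < r / 2 := by
  have h1 := h.sq_norm_le hp hfp
  have hμ := h.μ_pos
  have hr := h.r_pos
  have h2 : -(2 / μ) * fderiv ℝ f O (p - O) < (r / 2) ^ 2 := by
    have := mul_lt_mul_of_pos_left hh (by positivity : 0 < 2 / μ)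
    have e : 2 / μ * -(μ * r ^ 2 / 8) = -(r / 2) ^ 2 := by field_simp; ring
    linarith
  exact lt_of_pow_lt_pow_left₀ 2 (by positivity) (h1.trans_lt h2)

/-- The ray stays at the height of `q`, so by `norm_lt` it has left the set `f < 0` when it reaches
distance `r / 2` from `O`; the intermediate value theorem gives the root. -/
theorem exists_root (h : ConvexPatch f O r μ) {q v : E} (hq : q ∈ Metric.ball O r) (hfq : f q < 0)
    (hh : -(μ * r ^ 2 / 8) < fderiv ℝ f O (q - O)) (hv : v ≠ 0) (hv' : fderiv ℝ f O v = 0) :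
    ∃ t > (0 : ℝ), q + t • v ∈ Metric.ball O r ∧ f (q + t • v) = 0 := by
  have hr := h.r_pos
  have hqn := h.norm_lt hq hfq.le hh
  have hheight : ∀ t : ℝ, fderiv ℝ f O (q + t • v - O) = fderiv ℝ f O (q - O) := by
    intro t
    rw [add_sub_right_comm, map_add, map_smul, hv', smul_zero, add_zero]
  have hvn : 0 < ‖v‖ := norm_pos_iff.2 hv
  have hcn : Continuous fun t : ℝ => ‖q + t • v - O‖ := by fun_prop
  -- leave the ball of radius `r / 2`
  obtain ⟨T, hT, hTn⟩ : ∃ T > (0 : ℝ), ‖q + T • v - O‖ = r / 2 := by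
    have hbig : r / 2 ≤ ‖q + (r / ‖v‖) • v - O‖ := by
      have e1 : ‖(r / ‖v‖) • v‖ = r := by
        rw [norm_smul, Real.norm_of_nonneg (by positivity)]
        field_simp
      have e2 : ‖(r / ‖v‖) • v‖ ≤ ‖q + (r / ‖v‖) • v - O‖ + ‖q - O‖ := by
        calc ‖(r / ‖v‖) • v‖ = ‖(q + (r / ‖v‖) • v - O) - (q - O)‖ := by congr 1; abel
          _ ≤ _ := norm_sub_le _ _
      linarith
    obtain ⟨T, hT, hTn⟩ := intermediate_value_Icc (by positivity : (0 : ℝ) ≤ r / ‖v‖)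
      hcn.continuousOn ⟨by simpa using hqn.le, hbig⟩
    refine ⟨T, lt_of_le_of_ne hT.1 ?_, hTn⟩
    rintro rfl
    simp only [zero_smul, add_zero] at hTn
    linarith
  have hball : ∀ t ∈ Set.Icc 0 T, q + t • v ∈ Metric.ball O r := by
    intro t ht
    have hmem : q + t • v ∈ segment ℝ q (q + T • v) := by
      refine ⟨1 - t / T, t / T, ?_, by have := ht.1; positivity, by ring, ?_⟩
      · rw [sub_nonneg, div_le_one hT]; exact ht.2
      · have e : (t / T) • T • v = t • v := by rw [smul_smul, div_mul_cancel₀ _ hT.ne']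
        rw [smul_add, e]
        module
    refine (convex_ball O r).segment_subset hq ?_ hmem
    rw [Metric.mem_ball, dist_eq_norm, hTn]
    linarith
  have hTpos : 0 ≤ f (q + T • v) := by
    by_contra hcon
    rw [not_le] at hcon
    have := h.norm_lt (hball T ⟨hT.le, le_rfl⟩) hcon.le (by rw [hheight]; exact hh)
    linarith
  have hcont : ContinuousOn (fun t : ℝ => f (q + t • v)) (Set.Icc 0 T) := by
    intro t ht
    have h1 : ContinuousAt f (q + t • v) := (h.differentiableAt (hball t ht)).continuousAt
    have h2 : ContinuousAt (fun t : ℝ => q + t • v) t := by fun_prop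
    exact (ContinuousAt.comp (f := fun t : ℝ => q + t • v) h1 h2).continuousWithinAt
  obtain ⟨t, ht, htf⟩ := intermediate_value_Icc hT.le hcont ⟨by simpa using hfq.le, hTpos⟩
  refine ⟨t, lt_of_le_of_ne ht.1 ?_, hball t ht, htf⟩
  rintro rfl
  simp only [zero_smul, add_zero] at htf
  linarith

theorem fderiv_root_pos (h : ConvexPatch f O r μ) {q v : E} {t : ℝ} (hq : q ∈ Metric.ball O r)
    (hfq : f q < 0) (ht : 0 < t) (hp : q + t • v ∈ Metric.ball O r) (hfp : f (q + t • v) = 0) :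
    0 < fderiv ℝ f (q + t • v) v := by
  have h1 := h.fderiv_chord_neg hp hq hfp hfq.le (by
    intro h0
    rw [h0] at hfp
    linarith)
  rw [sub_add_cancel_left, map_neg, map_smul, smul_eq_mul] at h1
  by_contra hcon
  rw [not_lt] at hcon
  have := mul_nonpos_of_nonneg_of_nonpos ht.le hcon
  linarith

/-- At a root `f` increases along the ray, and convexity then forbids a later root. This identifies
a chosen root with the local implicit function. -/
theorem root_unique (h : ConvexPatch f O r μ) {q v : E} {t t' : ℝ} (hq : q ∈ Metric.ball O r)
    (hfq : f q < 0) (ht : 0 < t) (hp : q + t • v ∈ Metric.ball O r) (hfp : f (q + t • v) = 0)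
    (ht' : 0 < t') (hp' : q + t' • v ∈ Metric.ball O r) (hfp' : f (q + t' • v) = 0) : t = t' := by
  have key : ∀ {a b : ℝ}, 0 < a → q + a • v ∈ Metric.ball O r → f (q + a • v) = 0 →
      q + b • v ∈ Metric.ball O r → f (q + b • v) = 0 → ¬ a < b := by
    intro a b ha hpa hfa hpb hfb hab
    have h1 := h.fderiv_root_pos hq hfq ha hpa hfa
    have e : q + b • v - (q + a • v) = (b - a) • v := by module
    have h2 : 0 ≤ fderiv ℝ f (q + a • v) (q + b • v - (q + a • v)) := by
      rw [e, map_smul, smul_eq_mul]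
      exact mul_nonneg (by linarith) h1.le
    have hne : q + a • v ≠ q + b • v := by
      intro h0
      have : (b - a) • v = 0 := by rw [← e, h0, sub_self]
      rcases smul_eq_zero.1 this with h3 | h3
      · linarith
      · rw [h3, map_zero] at h1
        exact lt_irrefl _ h1
    linarith [h.fderiv_chord_neg hpa hpb hfa hfb.le hne]
  rcases lt_trichotomy t t' with h1 | h1 | h1
  · exact absurd h1 (key ht hp hfp hp' hfp')
  · exact h1
  · exact absurd h1 (key ht' hp' hfp' hp hfp)

/-- The root along a segment of interior points depends differentiably on the parameter. -/
theorem exists_root_curve (h : ConvexPatch f O r μ) {d v : E} (hv : v ≠ 0)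
    (hv' : fderiv ℝ f O v = 0) : ∃ a : ℝ → ℝ, ∀ τ : ℝ, O + τ • d ∈ Metric.ball O r →
      f (O + τ • d) < 0 → -(μ * r ^ 2 / 8) < τ * fderiv ℝ f O d →
      0 < a τ ∧ O + τ • d + a τ • v ∈ Metric.ball O r ∧ f (O + τ • d + a τ • v) = 0 ∧
      ∃ a', HasDerivAt a a' τ ∧ fderiv ℝ f (O + τ • d + a τ • v) (d + a' • v) = 0 := by
  -- The conditions on `τ` sit inside the existential so that the choice is a total function of `τ`;
  -- its values elsewhere are irrelevant.
  have hex : ∀ τ : ℝ, ∃ t : ℝ, O + τ • d ∈ Metric.ball O r → f (O + τ • d) < 0 →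
      -(μ * r ^ 2 / 8) < τ * fderiv ℝ f O d →
      0 < t ∧ O + τ • d + t • v ∈ Metric.ball O r ∧ f (O + τ • d + t • v) = 0 := by
    intro τ
    by_cases hc : O + τ • d ∈ Metric.ball O r ∧ f (O + τ • d) < 0 ∧
      -(μ * r ^ 2 / 8) < τ * fderiv ℝ f O d
    · obtain ⟨t, ht, h1, h2⟩ := h.exists_root hc.1 hc.2.1
        (by rw [add_sub_cancel_left, map_smul, smul_eq_mul]; exact hc.2.2) hv hv'
      exact ⟨t, fun _ _ _ => ⟨ht, h1, h2⟩⟩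
    · exact ⟨0, fun h1 h2 h3 => absurd ⟨h1, h2, h3⟩ hc⟩
  choose a ha using hex
  refine ⟨a, fun τ h1 h2 h3 => ?_⟩
  obtain ⟨ha0, hab, haf⟩ := ha τ h1 h2 h3
  refine ⟨ha0, hab, haf, ?_⟩
  set P : ℝ × ℝ → E := fun u => O + u.1 • d + u.2 • v with hP
  have hPc : ContDiff ℝ 1 P := by fun_prop
  have hG : ContDiffAt ℝ 1 (f ∘ P) (τ, a τ) :=
    ContDiffAt.comp (τ, a τ) ((h.contDiffAt _ hab).of_le (by norm_num)) hPc.contDiffAt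
  have hGd : DifferentiableAt ℝ (f ∘ P) (τ, a τ) := hG.differentiableAt one_ne_zero
  have hder : fderiv ℝ (f ∘ P) (τ, a τ) (0, 1) = fderiv ℝ f (O + τ • d + a τ • v) v := by
    have hline : HasDerivAt (fun y : ℝ => ((τ, y) : ℝ × ℝ)) (0, 1) (a τ) :=
      (hasDerivAt_const _ τ).prodMk (hasDerivAt_id _)
    have e1 := hGd.hasFDerivAt.comp_hasDerivAt (a τ) hline
    have e2 : HasDerivAt (fun y : ℝ => O + τ • d + y • v) ((1 : ℝ) • v) (a τ) :=
      ((hasDerivAt_id (a τ)).smul_const v).const_add _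
    have e3 := (h.differentiableAt hab).hasFDerivAt.comp_hasDerivAt (a τ) e2
    rw [one_smul] at e3
    exact e1.unique e3
  obtain ⟨φ, hφ, hφc, hφ0, -⟩ := exists_implicit_real one_ne_zero hG haf
    (by rw [hder]; exact (h.fderiv_root_pos h1 h2 ha0 hab haf).ne')
  have hφd : HasDerivAt φ (deriv φ τ) τ := (hφc.differentiableAt one_ne_zero).hasDerivAt
  have hcurve : HasDerivAt (fun t => O + t • d + φ t • v) (d + deriv φ τ • v) τ := by
    have e1 : HasDerivAt (fun t : ℝ => O + t • d) ((1 : ℝ) • d) τ :=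
      ((hasDerivAt_id τ).smul_const d).const_add O
    rw [one_smul] at e1
    exact e1.add (hφd.smul_const v)
  have hq : ContinuousAt (fun t : ℝ => O + t • d) τ := by fun_prop
  have haφ : a =ᶠ[𝓝 τ] φ := by
    have c1 : ∀ᶠ t in 𝓝 τ, O + t • d ∈ Metric.ball O r := hq (Metric.isOpen_ball.mem_nhds h1)
    have c2 : ∀ᶠ t in 𝓝 τ, f (O + t • d) < 0 :=
      (ContinuousAt.comp (f := fun t : ℝ => O + t • d)
        (h.differentiableAt h1).continuousAt hq).eventually_lt_const h2
    have c3 : ∀ᶠ t in 𝓝 τ, -(μ * r ^ 2 / 8) < t * fderiv ℝ f O d := by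
      have : ContinuousAt (fun t : ℝ => t * fderiv ℝ f O d) τ := by fun_prop
      exact this.eventually_const_lt h3
    have c4 : ∀ᶠ t in 𝓝 τ, 0 < φ t := hφd.continuousAt.eventually_const_lt (by rw [hφ]; exact ha0)
    have c5 : ∀ᶠ t in 𝓝 τ, O + t • d + φ t • v ∈ Metric.ball O r :=
      hcurve.continuousAt (Metric.isOpen_ball.mem_nhds (by rw [hφ]; exact hab))
    filter_upwards [c1, c2, c3, c4, c5, hφ0] with t i1 i2 i3 i4 i5 i6
    obtain ⟨j1, j2, j3⟩ := ha t i1 i2 i3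
    exact h.root_unique i1 i2 j1 j2 j3 i4 i5 i6
  refine ⟨deriv φ τ, hφd.congr_of_eventuallyEq haφ, ?_⟩
  have hpt : O + τ • d + a τ • v = O + τ • d + φ τ • v := by rw [hφ]
  have e4 : HasDerivAt (fun t => f (O + t • d + φ t • v))
      (fderiv ℝ f (O + τ • d + φ τ • v) (d + deriv φ τ • v)) τ :=
    HasFDerivAt.comp_hasDerivAt τ (hpt ▸ (h.differentiableAt hab).hasFDerivAt) hcurve
  rw [hpt]
  exact e4.unique ((hasDerivAt_const τ (0 : ℝ)).congr_of_eventuallyEq hφ0)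

/-- The midpoints of the chords parallel to a tangent vector `v` lie in the mirror of `v`. -/
theorem chord_symmetric (h : ConvexPatch f O r μ) {q v : E} {ω : E →L[ℝ] ℝ}
    (hω : IsHomologyFor f O r v ω) (hv : v ≠ 0) (hv' : fderiv ℝ f O v = 0)
    (hq : q ∈ Metric.ball O r) (hfq : f q < 0)
    (hh : -(μ * r ^ 2 / 8) < fderiv ℝ f O (q - O)) {α β : ℝ} (hα : 0 < α) (hβ : 0 < β)
    (hp : q + α • v ∈ Metric.ball O r) (hfp : f (q + α • v) = 0)
    (hp' : q - β • v ∈ Metric.ball O r) (hfp' : f (q - β • v) = 0) :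
    2 * ω (q - O) + α - β = 0 := by
  have hμ := h.μ_pos
  have hr := h.r_pos
  set d := q - O with hd
  have hq1 : O + (1 : ℝ) • d = q := by rw [one_smul, hd]; abel
  -- Let `q` slide along the segment to `O`; `a` and `b` measure, in units of `v`, the two parts of
  -- the chord through `O + τ d`.
  obtain ⟨a, ha⟩ := h.exists_root_curve (d := d) hv hv'
  obtain ⟨b, hb⟩ := h.exists_root_curve (d := d) (neg_ne_zero.2 hv) (by rw [map_neg, hv', neg_zero])
  have hfd : fderiv ℝ f O d < 0 := by
    have h1 := h.base_ineq hq
    have : 0 ≤ μ / 2 * ‖q - O‖ ^ 2 := by positivity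
    linarith
  -- points of the segment are interior
  have hin : ∀ τ ∈ Set.Ioc (0 : ℝ) 1, O + τ • d ∈ Metric.ball O r ∧ f (O + τ • d) < 0 ∧
      -(μ * r ^ 2 / 8) < τ * fderiv ℝ f O d := by
    intro τ hτ
    have hb : O + τ • d ∈ Metric.ball O r :=
      (convex_ball O r).segment_subset h.base_mem hq
        ⟨1 - τ, τ, by linarith [hτ.2], hτ.1.le, by ring, by rw [hd]; module⟩
    refine ⟨hb, ?_, ?_⟩
    · have h1 := h.convex _ hb O h.base_mem
      have h2 := h.convex _ hb q hq
      rw [h.map_base] at h1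
      have e1 : O - (O + τ • d) = -(τ • d) := by abel
      have e2 : q - (O + τ • d) = (1 - τ) • d := by rw [hd]; module
      rw [e1, map_neg, map_smul, smul_eq_mul] at h1
      rw [e2, map_smul, smul_eq_mul] at h2
      have h3 : 0 ≤ μ / 2 * ‖-(τ • d)‖ ^ 2 := by positivity
      have h4 : 0 ≤ μ / 2 * ‖(1 - τ) • d‖ ^ 2 := by positivity
      have h5 : f (O + τ • d) ≤ τ * fderiv ℝ f (O + τ • d) d := by linarith
      have h6 : f (O + τ • d) ≤ f q - (1 - τ) * fderiv ℝ f (O + τ • d) d := by linarith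
      have h7 := mul_le_mul_of_nonneg_left h5 (by linarith [hτ.2] : 0 ≤ 1 - τ)
      have h8 := mul_le_mul_of_nonneg_left h6 hτ.1.le
      have h9 : τ * f q < 0 := mul_neg_of_pos_of_neg hτ.1 hfq
      linarith
    · nlinarith [hτ.1, hτ.2]
  -- This function is twice `ω(m - O)`, where `m` is the midpoint of the chord. The velocities of
  -- the two ends are tangent to the patch, and the homology relating the tangent hyperplanes makes
  -- the derivative zero.
  have hder : ∀ τ ∈ Set.Ioc (0 : ℝ) 1,
      HasDerivAt (fun τ => 2 * τ * ω d + a τ - b τ) 0 τ := by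
    intro τ hτ
    obtain ⟨i1, i2, i3⟩ := hin τ hτ
    obtain ⟨a1, a2, a3, a', a4, a5⟩ := ha τ i1 i2 i3
    obtain ⟨b1, b2, b3, b', b4, b5⟩ := hb τ i1 i2 i3
    have pa := h.fderiv_root_pos i1 i2 a1 a2 a3
    have pb := h.fderiv_root_pos i1 i2 b1 b2 b3
    rw [map_neg] at pb
    set p := O + τ • d + a τ • v with hpdef
    set p' := O + τ • d + b τ • -v with hpdef'
    have hpp : p = p' + (a τ + b τ) • v := by rw [hpdef, hpdef']; module
    have hne : p' ≠ p := by
      intro h0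
      rw [h0] at pb
      linarith
    obtain ⟨k, hk⟩ := hω.2 p' b2 p a2 b3 a3 hne ⟨_, hpp⟩
    have k1 := hk v
    rw [hω.1] at k1
    have k2 := hk (d + a' • v)
    rw [a5, map_add, map_smul, map_add, map_smul, hω.1] at k2
    rw [map_add, map_smul, map_neg] at b5
    simp only [smul_eq_mul] at k2 b5
    have hk0 : k ≠ 0 := by
      rintro rfl
      rw [zero_mul] at k1
      linarith
    have e1 : k * fderiv ℝ f p' v * (2 * ω d + a' - b') = 0 := by
      linear_combination k2 + k * b5
    have e2 : 2 * ω d + a' - b' = 0 := by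
      rcases mul_eq_zero.1 e1 with h0 | h0
      · rcases mul_eq_zero.1 h0 with h0 | h0
        · exact absurd h0 hk0
        · linarith
      · exact h0
    have e3 : HasDerivAt (fun τ : ℝ => 2 * τ * ω d + a τ - b τ) (2 * 1 * ω d + a' - b') τ :=
      ((((hasDerivAt_id τ).const_mul 2).mul_const (ω d)).add a4).sub b4
    rwa [mul_one, e2] at e3
  have hconst : ∀ τ ∈ Set.Ioc (0 : ℝ) 1,
      2 * τ * ω d + a τ - b τ = 2 * ω d + a 1 - b 1 := by
    intro τ hτ
    have hsub : Set.Icc τ 1 ⊆ Set.Ioc 0 1 := fun x hx => ⟨hτ.1.trans_le hx.1, hx.2⟩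
    have := constant_of_derivWithin_zero (f := fun τ => 2 * τ * ω d + a τ - b τ) (a := τ) (b := 1)
      (fun x hx => (hder x (hsub hx)).differentiableAt.differentiableWithinAt)
      (fun x hx => (hder x (hsub ⟨hx.1, hx.2.le⟩)).hasDerivWithinAt.derivWithin
        (uniqueDiffOn_Icc (hx.1.trans_lt hx.2) x ⟨hx.1, hx.2.le⟩)) 1 ⟨hτ.2, le_rfl⟩
    simp only [mul_one] at this
    exact this.symm
  have hvn : 0 < ‖v‖ := norm_pos_iff.2 hv
  -- By `sq_norm_le` both parts of the chord are `O(√τ)`, so the constant is the limit `0`.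
  set g : ℝ → ℝ := fun τ => (√(-(2 / μ) * (τ * fderiv ℝ f O d)) + τ * ‖d‖) / ‖v‖ with hg
  have hbound : ∀ τ ∈ Set.Ioc (0 : ℝ) 1, ∀ (t : ℝ) (u : E), 0 < t → ‖u‖ = ‖v‖ →
      fderiv ℝ f O u = 0 →
      O + τ • d + t • u ∈ Metric.ball O r → f (O + τ • d + t • u) = 0 → t ≤ g τ := by
    intro τ hτ t u ht hu hu' hm hf0
    have h1 := h.sq_norm_le hm hf0.le
    have e : O + τ • d + t • u - O = τ • d + t • u := by abel
    rw [e, map_add, map_smul, map_smul, hu', smul_zero, add_zero, smul_eq_mul] at h1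
    have h2 := Real.le_sqrt_of_sq_le h1
    have h3 : ‖t • u‖ ≤ ‖τ • d + t • u‖ + ‖τ • d‖ := by
      calc ‖t • u‖ = ‖(τ • d + t • u) - τ • d‖ := by congr 1; abel
        _ ≤ _ := norm_sub_le _ _
    rw [norm_smul, norm_smul, hu, Real.norm_of_nonneg ht.le, Real.norm_of_nonneg hτ.1.le] at h3
    rw [hg, le_div_iff₀ hvn]
    linarith
  have hlim : Tendsto (fun τ => 2 * τ * |ω d| + g τ) (𝓝[>] 0) (𝓝 0) := by
    have hc : Continuous fun τ => 2 * τ * |ω d| + g τ := by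
      rw [hg]
      fun_prop
    have := hc.tendsto 0
    simp only [hg, mul_zero, zero_mul, Real.sqrt_zero, add_zero, zero_div] at this
    exact this.mono_left nhdsWithin_le_nhds
  have hle : |2 * ω d + a 1 - b 1| ≤ 0 := by
    refine ge_of_tendsto hlim ?_
    filter_upwards [Ioc_mem_nhdsGT (zero_lt_one' ℝ)] with τ hτ
    obtain ⟨i1, i2, i3⟩ := hin τ hτ
    obtain ⟨a1, a2, a3, -⟩ := ha τ i1 i2 i3
    obtain ⟨b1, b2, b3, -⟩ := hb τ i1 i2 i3
    have ga := hbound τ hτ _ _ a1 rfl hv' a2 a3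
    have gb := hbound τ hτ _ _ b1 (norm_neg v) (by rw [map_neg, hv', neg_zero]) b2 b3
    rw [← hconst τ hτ, abs_le]
    have := mul_le_mul_of_nonneg_left (le_abs_self (ω d)) hτ.1.le
    have := mul_le_mul_of_nonneg_left (neg_abs_le (ω d)) hτ.1.le
    constructor <;> linarith
  obtain ⟨i1, i2, i3⟩ := hin 1 ⟨zero_lt_one, le_rfl⟩
  obtain ⟨a1, a2, a3, -⟩ := ha 1 i1 i2 i3
  obtain ⟨b1, b2, b3, -⟩ := hb 1 i1 i2 i3
  rw [hq1] at a2 a3 b2 b3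
  have ea := h.root_unique hq hfq hα hp hfp a1 a2 a3
  rw [sub_eq_add_neg, ← smul_neg] at hp' hfp'
  have eb := h.root_unique hq hfq hβ hp' hfp' b1 b2 b3
  rw [ea, eb]
  exact abs_nonpos_iff.1 hle

/-- Endpoints of a chord are exchanged by the affine reflection. -/
theorem eq_reflection_of_chord (h : ConvexPatch f O r μ) {A v : E} {ω : E →L[ℝ] ℝ} {θ : ℝ}
    (hω : IsHomologyFor f O r v ω) (hv : v ≠ 0) (hv' : fderiv ℝ f O v = 0)
    (hA : A ∈ cap f O r μ) (hθ : θ ≠ 0) (hB : A + θ • v ∈ Metric.ball O r)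
    (hfB : f (A + θ • v) = 0) : 2 * ω (A - O) = -θ := by
  have key : ∀ {A : E} {θ : ℝ}, A ∈ cap f O r μ → 0 < θ → A + θ • v ∈ Metric.ball O r →
      f (A + θ • v) = 0 → 2 * ω (A - O) = -θ := by
    intro A θ hA hθ hB hfB
    set q := A + (θ / 2) • v with hq
    have hqb : q ∈ Metric.ball O r := (convex_ball O r).segment_subset hA.1 hB
      ⟨1 / 2, 1 / 2, by norm_num, by norm_num, by norm_num, by rw [hq]; module⟩
    have hne : A ≠ A + θ • v := by
      intro h0
      rw [left_eq_add] at h0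
      rcases smul_eq_zero.1 h0 with h1 | h1
      · exact hθ.ne' h1
      · exact hv h1
    have hfq : f q < 0 := by
      have h1 := h.convex q hqb A hA.1
      have h2 := h.convex q hqb _ hB
      have e1 : A - q = -((θ / 2) • v) := by rw [hq]; module
      have e2 : A + θ • v - q = (θ / 2) • v := by rw [hq]; module
      rw [e1, hA.2.1, map_neg] at h1
      rw [e2, hfB] at h2
      rw [norm_neg] at h1
      have h3 : 0 < ‖(θ / 2) • v‖ := norm_pos_iff.2 (smul_ne_zero (by positivity) hv)
      have : 0 < μ / 2 * ‖(θ / 2) • v‖ ^ 2 := by have := h.μ_pos; positivity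
      linarith
    have hhq : fderiv ℝ f O (q - O) = fderiv ℝ f O (A - O) := by
      rw [hq, add_sub_right_comm, map_add, map_smul, hv', smul_zero, add_zero]
    have hqa : q + (θ / 2) • v = A + θ • v := by rw [hq]; module
    have hqb' : q - (θ / 2) • v = A := by rw [hq]; module
    have := h.chord_symmetric hω hv hv' hqb hfq (by rw [hhq]; exact hA.2.2) (half_pos hθ)
      (half_pos hθ) (by rwa [hqa]) (by rwa [hqa]) (by rw [hqb']; exact hA.1)
      (by rw [hqb']; exact hA.2.1)
    have e : q - O = (A - O) + (θ / 2) • v := by rw [hq]; abel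
    rw [e, map_add, map_smul, hω.1, smul_eq_mul] at this
    linarith
  rcases lt_or_gt_of_ne hθ with hneg | hpos
  · have e : A + θ • v + (-θ) • v = A := by module
    have hh : fderiv ℝ f O (A + θ • v - O) = fderiv ℝ f O (A - O) := by
      rw [add_sub_right_comm, map_add, map_smul, hv', smul_zero, add_zero]
    have := key (A := A + θ • v) (θ := -θ) ⟨hB, hfB, by rw [hh]; exact hA.2.2⟩ (by linarith)
      (by rw [e]; exact hA.1) (by rw [e]; exact hA.2.1)
    rw [add_sub_right_comm, map_add, map_smul, hω.1, smul_eq_mul] at this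
    linarith
  · exact key hA hpos hB hfB

/-- Points of tangency with lines parallel to `v` lie in the mirror of `v`. -/
theorem tangent_mem_mirror (h : ConvexPatch f O r μ) {A v n : E} {ω : E →L[ℝ] ℝ}
    (hω : IsHomologyFor f O r v ω) (hv : v ≠ 0) (hv' : fderiv ℝ f O v = 0)
    (hA : A ∈ cap f O r μ) (hAv : fderiv ℝ f A v = 0) (hn : 0 < fderiv ℝ f A n) :
    ω (A - O) = 0 := by
  have hμ := h.μ_pos
  have hvn : 0 < ‖v‖ := norm_pos_iff.2 hv
  have hqc : Continuous fun s : ℝ => A + s • (-n) := by fun_prop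
  have hq0 : A + (0 : ℝ) • (-n) = A := by simp
  have ev1 : ∀ᶠ s in 𝓝[>] (0 : ℝ), f (A + s • (-n)) < 0 :=
    eventually_neg_of_fderiv_neg (h.differentiableAt hA.1) hA.2.1 (by rw [map_neg]; linarith)
  have ev2 : ∀ᶠ s in 𝓝[>] (0 : ℝ), A + s • (-n) ∈ Metric.ball O r :=
    nhdsWithin_le_nhds (hqc.continuousAt (Metric.isOpen_ball.mem_nhds (by rw [hq0]; exact hA.1)))
  have ev3 : ∀ᶠ s in 𝓝[>] (0 : ℝ), -(μ * r ^ 2 / 8) < fderiv ℝ f O (A + s • (-n) - O) := by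
    have hc : ContinuousAt (fun s : ℝ => fderiv ℝ f O (A + s • (-n) - O)) 0 := by fun_prop
    exact nhdsWithin_le_nhds (hc.eventually_const_lt (by simpa using hA.2.2))
  -- Convexity at `A` bounds both parts of the chord through the interior point `A - s n` by
  -- `O(√s)`; `chord_symmetric` then passes to the limit `s → 0`.
  set g : ℝ → ℝ := fun s => (√((2 / μ) * (s * fderiv ℝ f A n)) + s * ‖n‖) / ‖v‖ with hg
  have hlim : Tendsto (fun s => g s + 2 * s * |ω n|) (𝓝[>] 0) (𝓝 0) := by
    have hc : Continuous fun s => g s + 2 * s * |ω n| := by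
      rw [hg]
      fun_prop
    have := hc.tendsto 0
    simp only [hg, mul_zero, zero_mul, Real.sqrt_zero, add_zero, zero_div] at this
    exact this.mono_left nhdsWithin_le_nhds
  have hle : |2 * ω (A - O)| ≤ 0 := by
    refine ge_of_tendsto hlim ?_
    filter_upwards [ev1, ev2, ev3, self_mem_nhdsWithin] with s h1 h2 h3 hs
    have hs0 : (0 : ℝ) < s := hs
    have hbound : ∀ (t : ℝ) (u : E), 0 < t → ‖u‖ = ‖v‖ → fderiv ℝ f A u = 0 →
        A + s • (-n) + t • u ∈ Metric.ball O r → f (A + s • (-n) + t • u) = 0 → t ≤ g s := by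
      intro t u ht hu hu' hm hf0
      have i1 := h.convex A hA.1 _ hm
      have e : A + s • (-n) + t • u - A = t • u - s • n := by module
      rw [e, hA.2.1, hf0, map_sub, map_smul, map_smul, hu', smul_zero, zero_sub, smul_eq_mul] at i1
      have i2 : ‖t • u - s • n‖ ^ 2 ≤ (2 / μ) * (s * fderiv ℝ f A n) := by
        have e2 : ‖t • u - s • n‖ ^ 2 = (2 / μ) * (μ / 2 * ‖t • u - s • n‖ ^ 2) := by field_simp
        rw [e2]
        exact mul_le_mul_of_nonneg_left (by linarith) (by positivity)
      have i3 := Real.le_sqrt_of_sq_le i2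
      have i4 : ‖t • u‖ ≤ ‖t • u - s • n‖ + ‖s • n‖ := by
        calc ‖t • u‖ = ‖(t • u - s • n) + s • n‖ := by congr 1; abel
          _ ≤ _ := norm_add_le _ _
      rw [norm_smul, norm_smul s, hu, Real.norm_of_nonneg ht.le, Real.norm_of_nonneg hs0.le] at i4
      rw [hg, le_div_iff₀ hvn]
      linarith
    obtain ⟨a, a1, a2, a3⟩ := h.exists_root h2 h1 h3 hv hv'
    obtain ⟨b, b1, b2, b3⟩ := h.exists_root h2 h1 h3 (neg_ne_zero.2 hv)
      (by rw [map_neg, hv', neg_zero])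
    have ga := hbound _ _ a1 rfl hAv a2 a3
    have gb := hbound _ _ b1 (norm_neg v) (by rw [map_neg, hAv, neg_zero]) b2 b3
    rw [smul_neg b, ← sub_eq_add_neg] at b2 b3
    have hsym := h.chord_symmetric hω hv hv' h2 h1 h3 a1 b1 a2 a3 b2 b3
    have e : A + s • (-n) - O = (A - O) - s • n := by module
    rw [e, map_sub, map_smul, smul_eq_mul] at hsym
    have := mul_le_mul_of_nonneg_left (le_abs_self (ω n)) hs0.le
    have := mul_le_mul_of_nonneg_left (neg_abs_le (ω n)) hs0.le
    rw [abs_le]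
    constructor <;> linarith
  have := abs_nonpos_iff.1 hle
  linarith

/-- The affine reflection in a tangent direction preserves the cap. -/
theorem reflection_mem_cap (h : ConvexPatch f O r μ) {A v n : E} {ω : E →L[ℝ] ℝ}
    (hω : IsHomologyFor f O r v ω) (hv : v ≠ 0) (hv' : fderiv ℝ f O v = 0)
    (hn : ∀ x ∈ Metric.ball O r, 0 < fderiv ℝ f x n) (hA : A ∈ cap f O r μ) :
    A - (2 * ω (A - O)) • v ∈ cap f O r μ := by
  by_cases hAv : fderiv ℝ f A v = 0
  · rw [h.tangent_mem_mirror hω hv hv' hA hAv (hn A hA.1)]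
    simpa using hA
  -- A non-tangent line enters the sublevel set along `v` or `-v`; a short step inside allows
  -- `exists_root` to find its second end.
  have hpartner : ∀ u : E, u ≠ 0 → fderiv ℝ f O u = 0 → fderiv ℝ f A u < 0 →
      ∃ θ > (0 : ℝ), A + θ • u ∈ Metric.ball O r ∧ f (A + θ • u) = 0 := by
    intro u hu hu' hAu
    have hqc : Continuous fun s : ℝ => A + s • u := by fun_prop
    have ev1 := eventually_neg_of_fderiv_neg (h.differentiableAt hA.1) hA.2.1 hAu
    have ev2 : ∀ᶠ s in 𝓝[>] (0 : ℝ), A + s • u ∈ Metric.ball O r :=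
      nhdsWithin_le_nhds (hqc.continuousAt (Metric.isOpen_ball.mem_nhds (by simpa using hA.1)))
    obtain ⟨s, ⟨h1, h2⟩, hs⟩ := ((ev1.and ev2).and self_mem_nhdsWithin).exists
    obtain ⟨t, ht, h3, h4⟩ := h.exists_root h2 h1 (by
      rw [add_sub_right_comm, map_add, map_smul, hu', smul_zero, add_zero]
      exact hA.2.2) hu hu'
    have hs0 : (0 : ℝ) < s := hs
    rw [add_assoc, ← add_smul] at h3 h4
    exact ⟨s + t, by positivity, h3, h4⟩
  obtain ⟨θ, hθ, hB, hfB⟩ : ∃ θ : ℝ, θ ≠ 0 ∧ A + θ • v ∈ Metric.ball O r ∧ f (A + θ • v) = 0 := by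
    rcases lt_or_gt_of_ne hAv with hneg | hpos
    · obtain ⟨θ, h1, h2⟩ := hpartner v hv hv' hneg
      exact ⟨θ, h1.ne', h2⟩
    · obtain ⟨θ, h1, h2⟩ := hpartner (-v) (neg_ne_zero.2 hv) (by rw [map_neg, hv', neg_zero])
        (by rw [map_neg]; linarith)
      rw [smul_neg, ← neg_smul] at h2
      exact ⟨-θ, neg_ne_zero.2 h1.ne', h2⟩
  rw [h.eq_reflection_of_chord hω hv hv' hA hθ hB hfB, neg_smul, sub_neg_eq_add]
  refine ⟨hB, hfB, ?_⟩
  rw [add_sub_right_comm, map_add, map_smul, hv', smul_zero, add_zero]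
  exact hA.2.2

/-- Every tangent direction at the base point is the direction of a chord. -/
theorem exists_chord_of_tangent (h : ConvexPatch f O r μ) {v n : E} (hv : v ≠ 0)
    (hv' : fderiv ℝ f O v = 0) (hn : 0 < fderiv ℝ f O n) :
    ∃ A ∈ Metric.ball O r, ∃ B ∈ Metric.ball O r, f A = 0 ∧ f B = 0 ∧ A ≠ B ∧
      ∃ t : ℝ, B = A + t • v := by
  have hμ := h.μ_pos
  have hr := h.r_pos
  have hqc : Continuous fun s : ℝ => O + s • (-n) := by fun_prop
  have hq0 : O + (0 : ℝ) • (-n) = O := by simp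
  have ev1 : ∀ᶠ s in 𝓝[>] (0 : ℝ), f (O + s • (-n)) < 0 :=
    eventually_neg_of_fderiv_neg (h.differentiableAt h.base_mem) h.map_base
      (by rw [map_neg]; linarith)
  have ev2 : ∀ᶠ s in 𝓝[>] (0 : ℝ), O + s • (-n) ∈ Metric.ball O r :=
    nhdsWithin_le_nhds (hqc.continuousAt
      (Metric.isOpen_ball.mem_nhds (by rw [hq0]; exact h.base_mem)))
  have ev3 : ∀ᶠ s in 𝓝[>] (0 : ℝ), -(μ * r ^ 2 / 8) < fderiv ℝ f O (O + s • (-n) - O) := by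
    have hc : ContinuousAt (fun s : ℝ => fderiv ℝ f O (O + s • (-n) - O)) 0 := by fun_prop
    refine nhdsWithin_le_nhds (hc.eventually_const_lt ?_)
    simp only [zero_smul, add_zero, sub_self, map_zero]
    rw [neg_lt_zero]
    positivity
  obtain ⟨s, ⟨h1, h2⟩, h3⟩ := ((ev1.and ev2).and ev3).exists
  obtain ⟨a, a1, a2, a3⟩ := h.exists_root h2 h1 h3 hv hv'
  obtain ⟨b, b1, b2, b3⟩ := h.exists_root h2 h1 h3 (neg_ne_zero.2 hv)
    (by rw [map_neg, hv', neg_zero])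
  refine ⟨_, b2, _, a2, b3, a3, ?_, b + a, by module⟩
  have e : O + s • -n + a • v = O + s • -n + b • -v + (b + a) • v := by module
  rw [e, ne_eq, left_eq_add]
  exact smul_ne_zero (by positivity) hv

/-! ### Sections through the base point and the mirrors on the tangent hyperplane -/

/-- The plane section through the base point is the graph of a smooth function. -/
theorem exists_section (h : ConvexPatch f O r μ) {u n : E} (hn : fderiv ℝ f O n ≠ 0) :
    ∃ ζ : ℝ → ℝ, ζ 0 = 0 ∧ ContDiffAt ℝ 6 ζ 0 ∧
      (∀ᶠ t in 𝓝 0, O + t • u + ζ t • n ∈ cap f O r μ) ∧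
      ∀ᶠ w : ℝ × ℝ in 𝓝 (0, 0), f (O + w.1 • u + w.2 • n) = 0 → w.2 = ζ w.1 := by
  have hμ := h.μ_pos
  have hr := h.r_pos
  set P : ℝ × ℝ → E := fun w => O + w.1 • u + w.2 • n with hP
  have hPc : ContDiff ℝ 6 P := by fun_prop
  have hP0 : P (0, 0) = O := by simp [hP]
  have hG : ContDiffAt ℝ 6 (f ∘ P) (0, 0) :=
    ContDiffAt.comp (0, 0) (by rw [hP0]; exact h.contDiffAt O h.base_mem) hPc.contDiffAt
  have hder : fderiv ℝ (f ∘ P) (0, 0) (0, 1) = fderiv ℝ f O n := by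
    have hline : HasDerivAt (fun y : ℝ => ((0, y) : ℝ × ℝ)) (0, 1) 0 :=
      (hasDerivAt_const _ (0 : ℝ)).prodMk (hasDerivAt_id _)
    have e1 := (hG.differentiableAt (by norm_num)).hasFDerivAt.comp_hasDerivAt (0 : ℝ) hline
    have e2 : HasDerivAt (fun y : ℝ => O + (0 : ℝ) • u + y • n) ((1 : ℝ) • n) 0 :=
      ((hasDerivAt_id (0 : ℝ)).smul_const n).const_add _
    have e3 := HasFDerivAt.comp_hasDerivAt (0 : ℝ)
      (show HasFDerivAt f (fderiv ℝ f O) (O + (0 : ℝ) • u + (0 : ℝ) • n) by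
        simpa using (h.differentiableAt h.base_mem).hasFDerivAt) e2
    rw [one_smul] at e3
    exact e1.unique e3
  obtain ⟨ζ, h1, h2, h3, h4⟩ := exists_implicit_real (by norm_num) hG
    (by rw [Function.comp_apply, hP0, h.map_base]) (by rw [hder]; exact hn)
  refine ⟨ζ, h1, h2, ?_, h4⟩
  have hc : ContinuousAt (fun t : ℝ => O + t • u + ζ t • n) 0 :=
    (by fun_prop : ContinuousAt (fun t : ℝ => O + t • u) 0).add
      (h2.continuousAt.smul continuousAt_const)
  have c1 : ∀ᶠ t in 𝓝 (0 : ℝ), O + t • u + ζ t • n ∈ Metric.ball O r :=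
    hc (Metric.isOpen_ball.mem_nhds (by simpa [h1] using h.base_mem))
  have c2 : ∀ᶠ t in 𝓝 (0 : ℝ), -(μ * r ^ 2 / 8) < fderiv ℝ f O (O + t • u + ζ t • n - O) := by
    have hc' : ContinuousAt (fun t : ℝ => fderiv ℝ f O (O + t • u + ζ t • n - O)) 0 :=
      (fderiv ℝ f O).continuous.continuousAt.comp (hc.sub continuousAt_const)
    refine hc'.eventually_const_lt ?_
    simp only [zero_smul, add_zero, h1, sub_self, map_zero, neg_lt_zero]
    positivity
  filter_upwards [h3, c1, c2] with t i1 i2 i3 using ⟨i2, i1, i3⟩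

theorem fderiv_section (h : ConvexPatch f O r μ) {u n : E} {ζ : ℝ → ℝ} {ζ' t : ℝ}
    (hd : HasDerivAt ζ ζ' t) (hc : ∀ᶠ t in 𝓝 t, O + t • u + ζ t • n ∈ cap f O r μ) :
    fderiv ℝ f (O + t • u + ζ t • n) (u + ζ' • n) = 0 := by
  have e1 : HasDerivAt (fun t : ℝ => O + t • u) ((1 : ℝ) • u) t :=
    ((hasDerivAt_id t).smul_const u).const_add O
  rw [one_smul] at e1
  have e2 : HasDerivAt (fun t : ℝ => O + t • u + ζ t • n) (u + ζ' • n) t :=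
    e1.add (hd.smul_const n)
  have e3 := HasFDerivAt.comp_hasDerivAt t
    (h.differentiableAt hc.self_of_nhds.1).hasFDerivAt e2
  exact e3.unique ((hasDerivAt_const t (0 : ℝ)).congr_of_eventuallyEq
    (by filter_upwards [hc] with t ht using ht.2.1))

theorem hasFDerivAt_fderiv (h : ConvexPatch f O r μ) :
    HasFDerivAt (fderiv ℝ f) (fderiv ℝ (fderiv ℝ f) O) O :=
  ((h.contDiffAt O h.base_mem).fderiv_right (m := 1) (by norm_num)).differentiableAt
    one_ne_zero |>.hasFDerivAt

theorem hess_symm (h : ConvexPatch f O r μ) (x y : E) :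
    fderiv ℝ (fderiv ℝ f) O x y = fderiv ℝ (fderiv ℝ f) O y x :=
  ((h.contDiffAt O h.base_mem).isSymmSndFDerivAt
    (by rw [minSmoothness_of_isRCLikeNormedField]; norm_num)).eq x y

/-- The mirror of a tangent vector `v` meets the tangent hyperplane in the orthogonal complement
of `v` with respect to the Hessian. -/
theorem homology_apply_tangent (h : ConvexPatch f O r μ) {v n x : E} {ω : E →L[ℝ] ℝ}
    (hω : IsHomologyFor f O r v ω) (hv : v ≠ 0) (hv' : fderiv ℝ f O v = 0)
    (hn : ∀ x ∈ Metric.ball O r, 0 < fderiv ℝ f x n) (hx : fderiv ℝ f O x = 0) :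
    ω x = fderiv ℝ (fderiv ℝ f) O v x / fderiv ℝ (fderiv ℝ f) O v v := by
  have hnO := hn O h.base_mem
  obtain ⟨ζ, hζ0, hζc, hcap, -⟩ := h.exists_section (u := v) hnO.ne'
  have hζd : HasDerivAt ζ (deriv ζ 0) 0 := (hζc.differentiableAt (by norm_num)).hasDerivAt
  have hζ' : deriv ζ 0 = 0 := by
    have := h.fderiv_section hζd hcap
    simp only [hζ0, zero_smul, add_zero, map_add, map_smul, hv', zero_add, smul_eq_mul] at this
    exact (mul_eq_zero.1 this).resolve_right hnO.ne'
  rw [hζ'] at hζd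
  -- `A` is a curve on the patch leaving `O` with velocity `v`, and its reflected curve `B` leaves
  -- with velocity `-v`.
  set A : ℝ → E := fun t => O + t • v + ζ t • n with hA
  set B : ℝ → E := fun t => A t - (2 * ω (A t - O)) • v with hB
  have hA0 : A 0 = O := by simp [hA, hζ0]
  have hB0 : B 0 = O := by simp [hB, hA0]
  have hAd : HasDerivAt A v 0 := by
    have e1 : HasDerivAt (fun t : ℝ => O + t • v) ((1 : ℝ) • v) 0 :=
      ((hasDerivAt_id (0 : ℝ)).smul_const v).const_add O
    have e2 := e1.add (hζd.smul_const n)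
    rw [one_smul, zero_smul, add_zero] at e2
    exact e2
  have hsd : HasDerivAt (fun t => 2 * ω (A t - O)) 2 0 := by
    have e1 : HasDerivAt (fun t => ω (A t - O)) (ω v) 0 :=
      ω.hasFDerivAt.comp_hasDerivAt 0 (hAd.sub_const O)
    simpa [hω.1] using e1.const_mul 2
  have hBd : HasDerivAt B (-v) 0 := by
    have e1 := hAd.sub (hsd.smul_const v)
    have e2 : v - (2 : ℝ) • v = -v := by module
    rw [e2] at e1
    exact e1
  have hlim : ∀ (C : ℝ → E) (c y : E), C 0 = O → HasDerivAt C c 0 → fderiv ℝ f O y = 0 →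
      Tendsto (fun t => t⁻¹ * fderiv ℝ f (C t) y) (𝓝[≠] 0) (𝓝 (fderiv ℝ (fderiv ℝ f) O c y)) := by
    intro C c y hC0 hC hy
    have e1 := HasFDerivAt.comp_hasDerivAt (0 : ℝ)
      (show HasFDerivAt (fderiv ℝ f) (fderiv ℝ (fderiv ℝ f) O) (C 0) by
        rw [hC0]; exact h.hasFDerivAt_fderiv) hC
    have e2 : HasDerivAt (fun t => fderiv ℝ f (C t) y) (fderiv ℝ (fderiv ℝ f) O c y) 0 :=
      (ContinuousLinearMap.apply ℝ ℝ y).hasFDerivAt.comp_hasDerivAt 0 e1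
    simpa [hC0, hy] using hasDerivAt_iff_tendsto_slope_zero.1 e2
  -- Evaluating the homology on `v` and on `x` eliminates the unknown `k`; after division by `t²`
  -- each differential tends to a value of the Hessian.
  have hev : ∀ᶠ t in 𝓝[≠] (0 : ℝ), (t⁻¹ * fderiv ℝ f (B t) x) * (t⁻¹ * fderiv ℝ f (A t) v) =
      -(t⁻¹ * fderiv ℝ f (B t) v) * (t⁻¹ * fderiv ℝ f (A t) x -
        2 * (t⁻¹ * fderiv ℝ f (A t) v) * ω x) := by
    have hne : ∀ᶠ t in 𝓝[≠] (0 : ℝ), 2 * ω (A t - O) ≠ 0 := by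
      have := hsd.eventually_ne (c := (0 : ℝ)) two_ne_zero
      exact this
    filter_upwards [hne, nhdsWithin_le_nhds hcap] with t h1 h2
    have h3 := h.reflection_mem_cap hω hv hv' hn h2
    have hBA : B t = A t + (-(2 * ω (A t - O))) • v := by
      simp only [hB, neg_smul, ← sub_eq_add_neg]
    have hAB : A t ≠ B t := by
      rw [hBA, ne_eq, left_eq_add]
      exact smul_ne_zero (neg_ne_zero.2 h1) hv
    obtain ⟨k, hk⟩ := hω.2 (A t) h2.1 (B t) h3.1 h2.2.1 h3.2.1 hAB ⟨_, hBA⟩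
    have k1 := hk v
    rw [hω.1] at k1
    rw [hk x, k1]
    ring
  have l1 := (hlim B (-v) x hB0 hBd hx).mul (hlim A v v hA0 hAd hv')
  have l2 := (hlim B (-v) v hB0 hBd hv').neg.mul
    ((hlim A v x hA0 hAd hx).sub (((hlim A v v hA0 hAd hv').const_mul 2).mul_const (ω x)))
  have := tendsto_nhds_unique (l1.congr' hev) l2
  simp only [map_neg, _root_.neg_apply] at this
  have hQ := h.hess_pos v hv
  rw [eq_div_iff hQ.ne']
  have e : fderiv ℝ (fderiv ℝ f) O v v *
      (ω x * fderiv ℝ (fderiv ℝ f) O v v - fderiv ℝ (fderiv ℝ f) O v x) = 0 := by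
    linear_combination this / 2
  rcases mul_eq_zero.1 e with h0 | h0
  · exact absurd h0 hQ.ne'
  · linarith

/-! ### The common axis and rotational symmetry -/

/-- A linear map which preserves the cap, with the base point as the origin. -/
def PreservesCap (f : E → ℝ) (O : E) (r μ : ℝ) (L : E →ₗ[ℝ] E) : Prop :=
  ∀ p, O + p ∈ cap f O r μ → O + L p ∈ cap f O r μ

theorem PreservesCap.comp {L L' : E →ₗ[ℝ] E} (h : PreservesCap f O r μ L)
    (h' : PreservesCap f O r μ L') : PreservesCap f O r μ (L ∘ₗ L') :=
  fun p hp => h _ (h' p hp)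

/-- The linear reflection `x ↦ x - 2 ω(x) v`. -/
def reflectionMap (ω : E →L[ℝ] ℝ) (v : E) : E →ₗ[ℝ] E :=
  LinearMap.id - (2 : ℝ) • (ω : E →ₗ[ℝ] ℝ).smulRight v

@[simp] theorem reflectionMap_apply (ω : E →L[ℝ] ℝ) (v x : E) :
    reflectionMap ω v x = x - (2 * ω x) • v := by
  simp [reflectionMap, mul_smul]

theorem preservesCap_reflectionMap (h : ConvexPatch f O r μ) {v n : E} {ω : E →L[ℝ] ℝ}
    (hω : IsHomologyFor f O r v ω) (hv : v ≠ 0) (hv' : fderiv ℝ f O v = 0)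
    (hn : ∀ x ∈ Metric.ball O r, 0 < fderiv ℝ f x n) :
    PreservesCap f O r μ (reflectionMap ω v) := by
  intro p hp
  have := h.reflection_mem_cap hω hv hv' hn hp
  rwa [add_sub_cancel_left, add_sub_assoc, ← reflectionMap_apply] at this

/-- There are no translations along the tangent hyperplane taking points of the cap to the cap
twice. -/
theorem eq_zero_of_three_mem (h : ConvexPatch f O r μ) {A w : E} (h0 : A ∈ cap f O r μ)
    (h1 : A + w ∈ cap f O r μ) (h2 : A + w + w ∈ cap f O r μ) : w = 0 := by
  by_contra hw
  have e1 := h.fderiv_chord_neg h1.1 h0.1 h1.2.1 h0.2.1.le (by simpa using hw)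
  have e2 := h.fderiv_chord_neg h1.1 h2.1 h1.2.1 h2.2.1.le (by simpa using hw)
  rw [sub_add_cancel_left, map_neg] at e1
  rw [add_sub_cancel_left] at e2
  linarith

/-- A transversal contained in all the mirrors of the tangent directions. -/
theorem exists_axis [FiniteDimensional ℝ E] (h : ConvexPatch f O r μ) (hom : HasHomologies f O r)
    {n : E} (hn : ∀ x ∈ Metric.ball O r, 0 < fderiv ℝ f x n) :
    ∃ a : E, fderiv ℝ f O a < 0 ∧ ∀ (v : E) (ω : E →L[ℝ] ℝ), v ≠ 0 → fderiv ℝ f O v = 0 →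
      IsHomologyFor f O r v ω → ω a = 0 := by
  have hnO := hn O h.base_mem
  set T : Submodule ℝ E := LinearMap.ker (fderiv ℝ f O : E →ₗ[ℝ] ℝ) with hT
  have hTmem : ∀ x : E, x ∈ T ↔ fderiv ℝ f O x = 0 := fun x => by rw [hT, LinearMap.mem_ker]; rfl
  set Q : LinearMap.BilinForm ℝ T :=
    LinearMap.mk₂ ℝ (fun x y : T => fderiv ℝ (fderiv ℝ f) O (x : E) (y : E))
      (by intros; simp) (by intros; simp) (by intros; simp) (by intros; simp) with hQ
  have hQs : LinearMap.IsSymm Q := ⟨fun x y => by simp [hQ, h.hess_symm (x : E) (y : E)]⟩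
  obtain ⟨e, he⟩ := LinearMap.BilinForm.exists_orthogonal_basis hQs
  have he0 : ∀ i, (e i : E) ≠ 0 := fun i h0 => e.ne_zero i (Subtype.ext h0)
  have heT : ∀ i, fderiv ℝ f O (e i : E) = 0 := fun i => (hTmem _).1 (e i).2
  have hort : ∀ i j, i ≠ j → fderiv ℝ (fderiv ℝ f) O (e i : E) (e j : E) = 0 := fun i j hij => by
    simpa [hQ] using he hij
  have hex : ∀ i, ∃ ω, IsHomologyFor f O r (e i : E) ω := fun i =>
    hom _ (he0 i) (h.exists_chord_of_tangent (he0 i) (heT i) hnO)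
  choose ω hω using hex
  have hωe : ∀ i j, i ≠ j → ω i (e j : E) = 0 := fun i j hij => by
    rw [h.homology_apply_tangent (hω i) (he0 i) (heT i) hn (heT j), hort i j hij, zero_div]
  -- Since `ω i` vanishes on `e j` for `j ≠ i`, each summand corrects `-n` into one mirror without
  -- disturbing the others.
  set a : E := -n + ∑ i, ω i n • (e i : E) with ha
  have haO : fderiv ℝ f O a < 0 := by
    rw [ha, map_add, map_neg, map_sum]
    simp only [map_smul, heT, smul_zero, Finset.sum_const_zero, add_zero]
    linarith
  have hωa : ∀ j, ω j a = 0 := by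
    intro j
    rw [ha, map_add, map_neg, map_sum, Finset.sum_eq_single j]
    · rw [map_smul, (hω j).1]; simp
    · intro i _ hij
      rw [map_smul, hωe j i hij.symm, smul_zero]
    · simp
  clear_value a
  -- the central symmetry of the horizontal sections
  have hJ : ∀ s : Finset (Fin (Module.finrank ℝ T)), ∃ L : E →ₗ[ℝ] E, PreservesCap f O r μ L ∧
      L a = a ∧ ∀ i, L (e i : E) = if i ∈ s then -(e i : E) else (e i : E) := by
    intro s
    induction s using Finset.induction_on with
    | empty => exact ⟨LinearMap.id, fun p hp => hp, rfl, fun i => by simp⟩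
    | insert j s hj ih =>
      obtain ⟨L, h1, h2, h3⟩ := ih
      refine ⟨reflectionMap (ω j) (e j : E) ∘ₗ L,
        (h.preservesCap_reflectionMap (hω j) (he0 j) (heT j) hn).comp h1, ?_, fun i => ?_⟩
      · rw [LinearMap.comp_apply, h2, reflectionMap_apply, hωa]
        simp
      · rw [LinearMap.comp_apply, h3]
        rcases eq_or_ne i j with rfl | hij
        · rw [if_neg hj, if_pos (Finset.mem_insert_self _ _), reflectionMap_apply, (hω i).1]
          module
        · have := hωe j i hij.symm
          by_cases his : i ∈ s
          · rw [if_pos his, if_pos (Finset.mem_insert_of_mem his), reflectionMap_apply, map_neg,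
              this]
            simp
          · rw [if_neg his, if_neg (by simp [hij, his]), reflectionMap_apply, this]
            simp
  obtain ⟨J, hJp, hJa, hJe⟩ := hJ Finset.univ
  have hJT : ∀ x : E, fderiv ℝ f O x = 0 → J x = -x := by
    intro x hx
    have e1 : J ∘ₗ T.subtype = -T.subtype := e.ext fun i => by simp [hJe i]
    exact LinearMap.congr_fun e1 ⟨x, (hTmem x).2 hx⟩
  refine ⟨a, haO, fun v η hv hv' hη => ?_⟩
  have hR := h.preservesCap_reflectionMap hη hv hv' hn
  -- With `J = -1` on the tangent hyperplane and `J a = a`, the map `R J R J` is a shear: it fixes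
  -- the hyperplane and translates the level `z` by `-4 z η(a) v`.
  have hshear : ∀ (x : E) (z : ℝ), fderiv ℝ f O x = 0 → O + (x + z • a) ∈ cap f O r μ →
      O + (x + z • a) + (-(4 * z * η a)) • v ∈ cap f O r μ := by
    intro x z hx hp
    have h1 := (hR.comp (hJp.comp (hR.comp hJp))) _ hp
    have e1 : J (x + z • a) = -x + z • a := by rw [map_add, map_smul, hJT x hx, hJa]
    have e2 : reflectionMap η v (-x + z • a) = (-x + (2 * (η x - z * η a)) • v) + z • a := by
      rw [reflectionMap_apply, map_add, map_neg, map_smul, smul_eq_mul]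
      module
    have e3 : J ((-x + (2 * (η x - z * η a)) • v) + z • a) =
        (x - (2 * (η x - z * η a)) • v) + z • a := by
      rw [map_add, map_smul, hJa, hJT]
      · abel
      · rw [map_add, map_neg, map_smul, hx, hv']; simp
    rw [LinearMap.comp_apply, LinearMap.comp_apply, LinearMap.comp_apply, e1, e2, e3,
      reflectionMap_apply, map_add, map_sub, map_smul, map_smul, hη.1] at h1
    convert h1 using 1
    simp only [smul_eq_mul]
    module
  obtain ⟨ζ, hζ0, -, hcap, -⟩ := h.exists_section (u := v) hnO.ne'
  have hcap' : ∀ᶠ t in 𝓝[≠] (0 : ℝ), O + t • v + ζ t • n ∈ cap f O r μ := nhdsWithin_le_nhds hcap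
  -- A cap point off the tangent hyperplane has `z ≠ 0`; applying the shear twice gives three
  -- equally spaced collinear points.
  obtain ⟨t, ht, ht0⟩ := (hcap'.and self_mem_nhdsWithin).exists
  have ht0' : t ≠ 0 := ht0
  have hlow : fderiv ℝ f O (t • v + ζ t • n) < 0 := by
    have hne : O + (t • v + ζ t • n) ≠ O := by
      rw [ne_eq, add_eq_left]
      intro h0
      have e1 := congrArg (fderiv ℝ f O) h0
      rw [map_add, map_smul, map_smul, hv', map_zero, smul_zero, zero_add, smul_eq_mul] at e1
      have e2 := (mul_eq_zero.1 e1).resolve_right hnO.ne'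
      rw [e2, zero_smul, add_zero] at h0
      exact smul_ne_zero ht0' hv h0
    rw [add_assoc] at ht
    have := h.fderiv_chord_neg h.base_mem ht.1 h.map_base ht.2.1.le hne.symm
    rwa [add_sub_cancel_left] at this
  set p := t • v + ζ t • n with hp
  set z := fderiv ℝ f O p / fderiv ℝ f O a with hz
  have hz0 : z ≠ 0 := div_ne_zero hlow.ne haO.ne
  set x := p - z • a with hx
  have hx0 : fderiv ℝ f O x = 0 := by
    rw [hx, map_sub, map_smul, hz, smul_eq_mul, div_mul_cancel₀ _ haO.ne, sub_self]
  have hpx : O + (x + z • a) = O + t • v + ζ t • n := by rw [hx, hp]; module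
  have m0 : O + (x + z • a) ∈ cap f O r μ := by rw [hpx]; exact ht
  have m1 := hshear x z hx0 m0
  have e1 : O + (x + z • a) + (-(4 * z * η a)) • v =
      O + ((x + (-(4 * z * η a)) • v) + z • a) := by module
  have m2 := hshear (x + (-(4 * z * η a)) • v) z
    (by rw [map_add, map_smul, hx0, hv']; simp) (by rw [← e1]; exact m1)
  rw [← e1] at m2
  have := h.eq_zero_of_three_mem m0 m1 m2
  rcases smul_eq_zero.1 this with h1 | h1
  · have : 4 * z * η a = 0 := by linarith
    exact (mul_eq_zero.1 this).resolve_left (mul_ne_zero four_ne_zero hz0)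
  · exact absurd h1 hv

/-- Rotational symmetry of the cap about the axis. -/
theorem rotation_mem_cap (h : ConvexPatch f O r μ) (hom : HasHomologies f O r)
    {n a : E} (hn : ∀ x ∈ Metric.ball O r, 0 < fderiv ℝ f x n)
    (ha : ∀ (v : E) (ω : E →L[ℝ] ℝ), v ≠ 0 → fderiv ℝ f O v = 0 →
      IsHomologyFor f O r v ω → ω a = 0) {x y : E} {z : ℝ} (hx : fderiv ℝ f O x = 0)
    (hy : fderiv ℝ f O y = 0)
    (hxy : fderiv ℝ (fderiv ℝ f) O x x = fderiv ℝ (fderiv ℝ f) O y y)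
    (hp : O + x + z • a ∈ cap f O r μ) : O + y + z • a ∈ cap f O r μ := by
  rcases eq_or_ne x y with rfl | hne
  · exact hp
  have hv : x - y ≠ 0 := sub_ne_zero.2 hne
  have hv' : fderiv ℝ f O (x - y) = 0 := by rw [map_sub, hx, hy, sub_self]
  obtain ⟨ω, hω⟩ := hom _ hv (h.exists_chord_of_tangent hv hv' (hn O h.base_mem))
  have h1 := h.reflection_mem_cap hω hv hv' hn hp
  have hQ := h.hess_pos _ hv
  -- For vectors of equal `Q`-length the reflection in `x - y` takes `x` to `y`.
  have hωx : ω x = 1 / 2 := by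
    rw [h.homology_apply_tangent hω hv hv' hn hx, div_eq_iff hQ.ne']
    simp only [map_sub, _root_.sub_apply]
    rw [h.hess_symm y x]
    linarith
  have e : O + x + z • a - O = x + z • a := by abel
  rw [e, map_add, map_smul, ha _ ω hv hv' hω, hωx] at h1
  convert h1 using 1
  simp only [smul_zero, add_zero]
  module

/-! ### Conic profile and the quadric of revolution -/

/-- The section of the patch by a plane containing the axis is a conic symmetric with respect to
the axis. -/
theorem exists_conic_section (h : ConvexPatch f O r μ) (hom : HasHomologies f O r)
    {n a u : E} (hn : ∀ x ∈ Metric.ball O r, 0 < fderiv ℝ f x n) (haO : fderiv ℝ f O a < 0)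
    (ha : ∀ (v : E) (ω : E →L[ℝ] ℝ), v ≠ 0 → fderiv ℝ f O v = 0 →
      IsHomologyFor f O r v ω → ω a = 0) (hu : fderiv ℝ f O u = 0)
    (hu1 : fderiv ℝ (fderiv ℝ f) O u u = 1) :
    ∃ (ζ : ℝ → ℝ) (A B : ℝ), ζ 0 = 0 ∧ ContinuousAt ζ 0 ∧ 0 < B ∧
      (∀ᶠ t in 𝓝 0, O + t • u + ζ t • a ∈ cap f O r μ) ∧
      (∀ᶠ w : ℝ × ℝ in 𝓝 (0, 0), f (O + w.1 • u + w.2 • a) = 0 → w.2 = ζ w.1) ∧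
      ∀ᶠ t in 𝓝 0, t ^ 2 = A * ζ t ^ 2 + B * ζ t := by
  obtain ⟨ζ, hζ0, hζc, hcap, hsec⟩ := h.exists_section (u := u) haO.ne
  have hC : ∀ᶠ t in 𝓝 (0 : ℝ), ContDiffAt ℝ 6 ζ t := hζc.eventually (by simp)
  have hd : ∀ᶠ t in 𝓝 (0 : ℝ), HasDerivAt ζ (deriv ζ t) t := by
    filter_upwards [hC] with t ht using (ht.differentiableAt (by norm_num)).hasDerivAt
  have hd2 : HasDerivAt (deriv ζ) (deriv (deriv ζ) 0) 0 :=
    ((hζc.derivWithin (m := 5) (by norm_num)).differentiableAt (by norm_num)).hasDerivAt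
  have hsecd : ∀ᶠ t in 𝓝 (0 : ℝ), fderiv ℝ f (O + t • u + ζ t • a) u +
      deriv ζ t * fderiv ℝ f (O + t • u + ζ t • a) a = 0 := by
    filter_upwards [hd, hcap.eventually_nhds] with t h1 h2
    simpa using h.fderiv_section h1 h2
  have hζ' : deriv ζ 0 = 0 := by
    have := hsecd.self_of_nhds
    simp only [hζ0, zero_smul, add_zero, hu, zero_add] at this
    exact (mul_eq_zero.1 this).resolve_right haO.ne
  have hpd : HasDerivAt (fun t : ℝ => O + t • u + ζ t • a) u 0 := by
    have e1 : HasDerivAt (fun t : ℝ => O + t • u) ((1 : ℝ) • u) 0 :=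
      ((hasDerivAt_id (0 : ℝ)).smul_const u).const_add O
    have e2 := e1.add (hd.self_of_nhds.smul_const a)
    rw [one_smul, hζ', zero_smul, add_zero] at e2
    exact e2
  have hp0 : O + (0 : ℝ) • u + ζ 0 • a = O := by simp [hζ0]
  have hgd : HasDerivAt (fun t : ℝ => fderiv ℝ f (O + t • u + ζ t • a))
      (fderiv ℝ (fderiv ℝ f) O u) 0 :=
    HasFDerivAt.comp_hasDerivAt (0 : ℝ)
      (show HasFDerivAt (fderiv ℝ f) (fderiv ℝ (fderiv ℝ f) O) (O + (0 : ℝ) • u + ζ 0 • a) by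
        rw [hp0]; exact h.hasFDerivAt_fderiv) hpd
  have hgdx : ∀ x, HasDerivAt (fun t : ℝ => fderiv ℝ f (O + t • u + ζ t • a) x)
      (fderiv ℝ (fderiv ℝ f) O u x) 0 := fun x =>
    (ContinuousLinearMap.apply ℝ ℝ x).hasFDerivAt.comp_hasDerivAt 0 hgd
  -- The second derivative of `f = 0` along the section at `O` gives `Q u u + ζ''(0) df(a) = 0`,
  -- with `df(a) < 0`.
  have hζ'' : 0 < deriv (deriv ζ) 0 := by
    have e1 := (hgdx u).add (hd2.mul (hgdx a))
    have e2 := e1.unique ((hasDerivAt_const (0 : ℝ) (0 : ℝ)).congr_of_eventuallyEq hsecd)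
    rw [hu1, hp0, hζ', zero_mul, add_zero] at e2
    by_contra hcon
    rw [not_lt] at hcon
    have := mul_nonneg_of_nonpos_of_nonpos hcon haO.le
    linarith
  have hpos : ∀ᶠ t in 𝓝 (0 : ℝ), 0 < deriv (deriv ζ) t :=
    ((hζc.derivWithin (m := 5) (by norm_num)).derivWithin (m := 4)
      (by norm_num)).continuousAt.eventually_const_lt hζ''
  have hane : ∀ᶠ t in 𝓝 (0 : ℝ), fderiv ℝ f (O + t • u + ζ t • a) a < 0 :=
    (hgdx a).continuousAt.eventually_lt_const (by simpa [hζ0] using haO)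
  have heven : ∀ᶠ t in 𝓝 (0 : ℝ), ζ (-t) = ζ t := by
    have hlim : Tendsto (fun t : ℝ => (-t, ζ t)) (𝓝 0) (𝓝 (0, 0)) := by
      have hc : ContinuousAt (fun t : ℝ => (-t, ζ t)) 0 :=
        continuousAt_neg.prodMk hζc.continuousAt
      simpa [ContinuousAt, hζ0] using hc
    filter_upwards [hcap, hlim.eventually hsec] with t h1 h2
    have h3 := h.rotation_mem_cap hom hn ha (x := t • u) (y := (-t) • u) (z := ζ t)
      (by rw [map_smul, hu, smul_zero]) (by rw [map_smul, hu, smul_zero])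
      (by simp) h1
    exact (h2 h3.2.1).symm
  obtain ⟨ε, hε, hall⟩ := Metric.eventually_nhds_iff_ball.1
    (hC.and (hpos.and (hane.and (heven.and (hcap.and hsecd)))))
  rw [Real.ball_eq_Ioo, zero_sub, zero_add] at hall
  have hu0 : u ≠ 0 := by
    rintro rfl
    simp at hu1
  obtain ⟨A, B, hB, hAB⟩ := even_curve_conic hε (fun t ht => (hall t ht).1.of_le (by norm_num))
    (fun t ht => (hall t ht).2.1) (fun t ht => (hall t ht).2.2.2.1) hζ0
    (fun s t₁ ht₁ t₂ ht₂ hne hs => by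
      have hv : u + s • a ≠ 0 := by
        intro h0
        have e1 := congrArg (fderiv ℝ f O) h0
        rw [map_add, map_smul, hu, zero_add, map_zero, smul_eq_mul] at e1
        have e2 := (mul_eq_zero.1 e1).resolve_right haO.ne
        rw [e2, zero_smul, add_zero] at h0
        exact hu0 h0
      have hchord : ∀ t X : ℝ, ζ X - ζ t = s * (X - t) →
          O + X • u + ζ X • a = O + t • u + ζ t • a + (X - t) • (u + s • a) := by
        intro t X hs
        have : ζ X = ζ t + s * (X - t) := by linarith
        rw [this]
        module
      have hpne : ∀ t X : ℝ, t ≠ X → ζ X - ζ t = s * (X - t) →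
          O + t • u + ζ t • a ≠ O + X • u + ζ X • a := by
        intro t X htX hs
        rw [hchord t X hs, ne_eq, left_eq_add]
        exact smul_ne_zero (sub_ne_zero.2 htX.symm) hv
      obtain ⟨-, -, -, -, hc1, -⟩ := hall t₁ ht₁
      obtain ⟨-, -, -, -, hc2, -⟩ := hall t₂ ht₂
      obtain ⟨ω, hω1, hω⟩ := hom _ hv ⟨_, hc1.1, _, hc2.1, hc1.2.1, hc2.2.1, hpne _ _ hne hs,
        _, hchord _ _ hs⟩
      -- Tangency gives `df(u + s a) = (s - ζ') df(a)` along the curve; evaluating the homology on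
      -- `u + s a` and on `a` and eliminating `k` leaves the slope involution with `c = 2 ω(a)`.
      refine ⟨2 * ω a, fun t ht X hX htX hsX => ?_⟩
      obtain ⟨-, -, ha1, -, hm1, hs1⟩ := hall t ht
      obtain ⟨-, -, ha2, -, hm2, hs2⟩ := hall X hX
      obtain ⟨k, hk⟩ := hω _ hm1.1 _ hm2.1 hm1.2.1 hm2.2.1 (hpne _ _ htX hsX) ⟨_, hchord _ _ hsX⟩
      have k1 := hk (u + s • a)
      have k2 := hk a
      rw [hω1] at k1
      simp only [map_add, map_smul, smul_eq_mul] at k1 k2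
      set DA := fderiv ℝ f (O + t • u + ζ t • a)
      set DB := fderiv ℝ f (O + X • u + ζ X • a)
      have hk0 : k ≠ 0 := by
        rintro rfl
        rw [zero_mul] at k2
        linarith
      have hprod : k * DA a * ((deriv ζ X - s) * (1 + 2 * ω a * (deriv ζ t - s)) +
          (deriv ζ t - s)) = 0 := by
        linear_combination (k * (1 + 2 * ω a * (deriv ζ X - s))) * hs1 + hs2 - k1 -
          (deriv ζ X - s) * k2
      rcases mul_eq_zero.1 hprod with h0 | h0
      · exact absurd h0 (mul_ne_zero hk0 ha1.ne)
      · linarith)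
  refine ⟨ζ, A, B, hζ0, hζc.continuousAt, hB, hcap, hsec, ?_⟩
  filter_upwards [isOpen_Ioo.mem_nhds (show (0 : ℝ) ∈ Set.Ioo (-ε) ε from ⟨by linarith, hε⟩)]
    with t ht using hAB t ht

/-- Rotation about the axis takes `p` to the profile plane, to the point with coordinates `R p` (the
`Q`-length of the tangential part) and `Z (p - O)`. The equation of the profile then becomes `R² = A
Z² + B Z`, which is quadratic in `p`. -/
theorem exists_quadric_of_homologies [FiniteDimensional ℝ E] (h : ConvexPatch f O r μ)
    (hom : HasHomologies f O r) {n : E} (hn : ∀ x ∈ Metric.ball O r, 0 < fderiv ℝ f x n)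
    (hdim : ∃ u ≠ 0, fderiv ℝ f O u = 0) :
    ∃ (q : QuadraticForm ℝ E) (l : E →ₗ[ℝ] ℝ) (c : ℝ), q ≠ 0 ∧
      ∀ᶠ x in 𝓝 O, f x = 0 ↔ q x + l x + c = 0 := by
  have hμ := h.μ_pos
  have hr := h.r_pos
  obtain ⟨a, haO, ha⟩ := h.exists_axis hom hn
  set Q := fderiv ℝ (fderiv ℝ f) O with hQdef
  obtain ⟨u, hu, hu1⟩ : ∃ u, fderiv ℝ f O u = 0 ∧ Q u u = 1 := by
    obtain ⟨w, hw, hw'⟩ := hdim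
    have hQ : 0 < Q w w := h.hess_pos w hw
    refine ⟨(√(Q w w))⁻¹ • w, by rw [map_smul, hw', smul_zero], ?_⟩
    simp only [map_smul, _root_.smul_apply, smul_eq_mul]
    rw [← mul_assoc, ← mul_inv, Real.mul_self_sqrt hQ.le, inv_mul_cancel₀ hQ.ne']
  obtain ⟨ζ, A, B, hζ0, hζc, hB, hcap, hsec, hconic⟩ :=
    h.exists_conic_section hom hn haO ha hu hu1
  have hQ0 : ∀ x, 0 ≤ Q x x := fun x => by
    rcases eq_or_ne x 0 with rfl | hx
    · simp
    · exact (h.hess_pos x hx).le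
  -- coordinates along the axis and along the tangent hyperplane
  set Z : E →L[ℝ] ℝ := (fderiv ℝ f O a)⁻¹ • fderiv ℝ f O with hZ
  have hZa : ∀ y, Z y = (fderiv ℝ f O a)⁻¹ * fderiv ℝ f O y := fun y => rfl
  set X : E →L[ℝ] E := ContinuousLinearMap.id ℝ E - Z.smulRight a with hX
  have hXa : ∀ y, X y = y - Z y • a := fun y => rfl
  have hXT : ∀ y, fderiv ℝ f O (X y) = 0 := by
    intro y
    rw [hXa, map_sub, map_smul, hZa, smul_eq_mul, inv_mul_eq_div, div_mul_cancel₀ _ haO.ne,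
      sub_self]
  have hdec : ∀ p, O + X (p - O) + Z (p - O) • a = p := by
    intro p
    rw [hXa]
    abel
  set bil : LinearMap.BilinForm ℝ E :=
    LinearMap.mk₂ ℝ (fun x y => Q (X x) (X y) - A * (Z x * Z y))
      (by intros; simp; ring) (by intros; simp; ring) (by intros; simp; ring)
      (by intros; simp; ring) with hbil
  have hbila : ∀ x y, bil x y = Q (X x) (X y) - A * (Z x * Z y) := fun x y => rfl
  have hbils : ∀ x y, bil x y = bil y x := fun x y => by
    rw [hbila, hbila, hQdef, h.hess_symm, mul_comm (Z x)]
  refine ⟨bil.toQuadraticMap, (-2 : ℝ) • bil O - B • (Z : E →ₗ[ℝ] ℝ), bil O O + B * Z O, ?_, ?_⟩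
  · intro h0
    have h1 : bil.toQuadraticMap u = 0 := by rw [h0]; rfl
    have hZu : Z u = 0 := by rw [hZa, hu, mul_zero]
    have hXu : X u = u := by rw [hXa, hZu, zero_smul, sub_zero]
    rw [LinearMap.BilinMap.toQuadraticMap_apply, hbila, hXu, hZu, hu1] at h1
    norm_num at h1
  have heq : ∀ p, bil.toQuadraticMap p + ((-2 : ℝ) • bil O - B • (Z : E →ₗ[ℝ] ℝ)) p +
      (bil O O + B * Z O) = Q (X (p - O)) (X (p - O)) - A * Z (p - O) ^ 2 - B * Z (p - O) := by
    intro p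
    have e1 : bil (p - O) (p - O) =
        Q (X (p - O)) (X (p - O)) - A * (Z (p - O) * Z (p - O)) := hbila _ _
    have e2 : bil (p - O) (p - O) = bil p p - 2 * bil O p + bil O O := by
      simp only [map_sub, LinearMap.sub_apply]
      rw [hbils p O]
      ring
    have e3 : Z (p - O) = Z p - Z O := map_sub _ _ _
    rw [LinearMap.BilinMap.toQuadraticMap_apply, LinearMap.sub_apply, LinearMap.smul_apply,
      LinearMap.smul_apply, smul_eq_mul, smul_eq_mul, ContinuousLinearMap.coe_coe]
    linear_combination e1 - e2 + B * e3
  set R : E → ℝ := fun p => √(Q (X (p - O)) (X (p - O))) with hR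
  have hZc : Continuous fun p => Z (p - O) := by fun_prop
  have hRc : Continuous R := by
    have : Continuous fun p => Q (X (p - O)) (X (p - O)) :=
      (Q.continuous.comp (X.continuous.comp (continuous_id.sub continuous_const))).clm_apply
        (X.continuous.comp (continuous_id.sub continuous_const))
    exact this.sqrt
  have hR0 : R O = 0 := by simp [hR]
  have hRlim : Tendsto R (𝓝 O) (𝓝 0) := hR0 ▸ hRc.tendsto O
  have hZlim : Tendsto (fun p => Z (p - O)) (𝓝 O) (𝓝 0) := by simpa using hZc.tendsto O
  have hRZ : Tendsto (fun p => (R p, Z (p - O))) (𝓝 O) (𝓝 (0, 0)) := hRlim.prodMk_nhds hZlim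
  have hζR : Tendsto (fun p => ζ (R p)) (𝓝 O) (𝓝 0) := by
    have : Tendsto ζ (𝓝 0) (𝓝 0) := by simpa [ContinuousAt, hζ0] using hζc
    exact this.comp hRlim
  have hsum : Tendsto (fun p => A * (Z (p - O) + ζ (R p)) + B) (𝓝 O) (𝓝 B) := by
    simpa using ((hZlim.add hζR).const_mul A).add_const B
  have hheight : ∀ᶠ p in 𝓝 O, -(μ * r ^ 2 / 8) < fderiv ℝ f O (p - O) := by
    have hc : Continuous fun p => fderiv ℝ f O (p - O) := by fun_prop
    refine hc.continuousAt.eventually_const_lt ?_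
    simp only [sub_self, map_zero, neg_lt_zero]
    positivity
  filter_upwards [hheight, Metric.isOpen_ball.mem_nhds h.base_mem, hRZ.eventually hsec,
    hRlim.eventually hconic, hRlim.eventually hcap, hsum.eventually_const_lt hB]
    with p h1 h2 h3 h4 h5 h6
  have hR2 : R p ^ 2 = Q (X (p - O)) (X (p - O)) := Real.sq_sqrt (hQ0 _)
  have hTu : fderiv ℝ f O (R p • u) = 0 := by rw [map_smul, hu, smul_zero]
  have hQR : Q (X (p - O)) (X (p - O)) = Q (R p • u) (R p • u) := by
    simp only [map_smul, _root_.smul_apply, smul_eq_mul]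
    rw [hu1, ← hR2]
    ring
  rw [heq]
  constructor
  · intro hfp
    have m0 : O + X (p - O) + Z (p - O) • a ∈ cap f O r μ := by
      rw [hdec]
      exact ⟨h2, hfp, h1⟩
    have m1 := h.rotation_mem_cap hom hn ha (hXT _) hTu hQR m0
    have hz := h3 m1.2.1
    rw [← hR2, h4, ← hz]
    ring
  · intro hfp
    -- The conic may have a second branch over the same `R`; near `O` its factor is close to `B >
    -- 0`, so it does not vanish.
    have e1 : (Z (p - O) - ζ (R p)) * (A * (Z (p - O) + ζ (R p)) + B) = 0 := by
      linear_combination h4 - hR2 - hfp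
    rcases mul_eq_zero.1 e1 with h0 | h0
    · have hz : ζ (R p) = Z (p - O) := by linarith
      rw [hz] at h5
      have m1 := h.rotation_mem_cap hom hn ha hTu (hXT _) hQR.symm h5
      rw [hdec] at m1
      exact m1.2.1
    · exact absurd h0 h6.ne'

end ConvexPatch

/-! ### A uniformly convex defining function from the second fundamental form -/

/-- Second order Taylor inequality on the unit interval. -/
theorem taylor_lower_bound {g g₁ g₂ : ℝ → ℝ} {m : ℝ}
    (h₁ : ∀ t ∈ Set.Icc (0 : ℝ) 1, HasDerivAt g (g₁ t) t)
    (h₂ : ∀ t ∈ Set.Icc (0 : ℝ) 1, HasDerivAt g₁ (g₂ t) t)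
    (hm : ∀ t ∈ Set.Icc (0 : ℝ) 1, m ≤ g₂ t) : g 0 + g₁ 0 + m / 2 ≤ g 1 := by
  have hmono₁ : MonotoneOn (fun t => g₁ t - m * t) (Set.Icc 0 1) := by
    have hd : ∀ t ∈ Set.Icc (0 : ℝ) 1, HasDerivAt (fun t => g₁ t - m * t) (g₂ t - m) t :=
      fun t ht => ((h₂ t ht).sub ((hasDerivAt_id t).const_mul m)).congr_deriv (by simp)
    refine monotoneOn_of_deriv_nonneg (convex_Icc 0 1)
      (fun t ht => (hd t ht).continuousAt.continuousWithinAt)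
      (fun t ht => (hd t (interior_subset ht)).differentiableAt.differentiableWithinAt)
      fun t ht => ?_
    rw [(hd t (interior_subset ht)).deriv]
    linarith [hm t (interior_subset ht)]
  have hmono : MonotoneOn (fun t => g t - g₁ 0 * t - m / 2 * t ^ 2) (Set.Icc 0 1) := by
    have hd : ∀ t ∈ Set.Icc (0 : ℝ) 1,
        HasDerivAt (fun t => g t - g₁ 0 * t - m / 2 * t ^ 2) (g₁ t - g₁ 0 - m * t) t := by
      intro t ht
      refine (((h₁ t ht).sub ((hasDerivAt_id t).const_mul (g₁ 0))).sub
        ((hasDerivAt_pow 2 t).const_mul (m / 2))).congr_deriv ?_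
      simp
      ring
    refine monotoneOn_of_deriv_nonneg (convex_Icc 0 1)
      (fun t ht => (hd t ht).continuousAt.continuousWithinAt)
      (fun t ht => (hd t (interior_subset ht)).differentiableAt.differentiableWithinAt)
      fun t ht => ?_
    have ht' := interior_subset ht
    rw [(hd t ht').deriv]
    have := hmono₁ ⟨le_rfl, zero_le_one⟩ ht' ht'.1
    simp only [mul_zero, sub_zero] at this
    linarith
  have := hmono ⟨le_rfl, zero_le_one⟩ ⟨zero_le_one, le_rfl⟩ zero_le_one
  simp only [mul_zero, sub_zero, mul_one, one_pow] at this
  norm_num at this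
  linarith

/-- A positive definite quadratic form on a finite-dimensional space is coercive. -/
theorem exists_coercive [FiniteDimensional ℝ E] {q : E → ℝ} (hq : Continuous q)
    (hhom : ∀ (c : ℝ) x, q (c • x) = c ^ 2 * q x) (hpos : ∀ x ≠ 0, 0 < q x) :
    ∃ m > 0, ∀ x, m * ‖x‖ ^ 2 ≤ q x := by
  have hsph : ∃ m > 0, ∀ x ∈ Metric.sphere (0 : E) 1, m ≤ q x := by
    rcases (Metric.sphere (0 : E) 1).eq_empty_or_nonempty with he | hne
    · exact ⟨1, one_pos, by simp [he]⟩
    · obtain ⟨x, hx, hmin⟩ := (isCompact_sphere (0 : E) 1).exists_isMinOn hne hq.continuousOn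
      exact ⟨q x, hpos x (ne_zero_of_mem_unit_sphere ⟨x, hx⟩), fun y hy => hmin hy⟩
  obtain ⟨m, hm, hle⟩ := hsph
  refine ⟨m, hm, fun x => ?_⟩
  rcases eq_or_ne x 0 with rfl | hx
  · have := hhom 0 0
    simp at this
    simp [this]
  · have hn : 0 < ‖x‖ := norm_pos_iff.2 hx
    have h1 := hle (‖x‖⁻¹ • x) (by
      rw [mem_sphere_zero_iff_norm, norm_smul, norm_inv, norm_norm, inv_mul_cancel₀ hn.ne'])
    have h2 : q x = ‖x‖ ^ 2 * q (‖x‖⁻¹ • x) := by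
      rw [hhom]
      field_simp
    rw [h2, mul_comm]
    exact mul_le_mul_of_nonneg_left h1 (by positivity)

/-- Finsler's lemma: a quadratic form positive on the hyperplane `l = 0` becomes positive definite
after adding a large multiple of `l²`. -/
theorem exists_pos_add_sq [FiniteDimensional ℝ E] {q l : E → ℝ} (hq : Continuous q)
    (hl : Continuous l) (hhom : ∀ (c : ℝ) x, q (c • x) = c ^ 2 * q x)
    (hlhom : ∀ (c : ℝ) x, l (c • x) = c * l x) (hpos : ∀ x ≠ 0, l x = 0 → 0 < q x) :
    ∃ k ≥ 0, ∀ x ≠ 0, 0 < q x + k * l x ^ 2 := by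
  suffices hs : ∃ k ≥ 0, ∀ x ∈ Metric.sphere (0 : E) 1, 0 < q x + k * l x ^ 2 by
    obtain ⟨k, hk, h⟩ := hs
    refine ⟨k, hk, fun x hx => ?_⟩
    have hn : 0 < ‖x‖ := norm_pos_iff.2 hx
    have h1 := h (‖x‖⁻¹ • x) (by
      rw [mem_sphere_zero_iff_norm, norm_smul, norm_inv, norm_norm, inv_mul_cancel₀ hn.ne'])
    rw [hhom, hlhom] at h1
    have h2 : q x + k * l x ^ 2 = ‖x‖ ^ 2 * (‖x‖⁻¹ ^ 2 * q x + k * (‖x‖⁻¹ * l x) ^ 2) := by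
      field_simp
    rw [h2]
    positivity
  -- On this compact set `l` has no zero, so `l²` has a positive minimum there, and a suitable
  -- multiple outweighs the minimum of `q`.
  set K := Metric.sphere (0 : E) 1 ∩ q ⁻¹' Set.Iic 0
  have hK : IsCompact K := (isCompact_sphere (0 : E) 1).inter_right (isClosed_Iic.preimage hq)
  rcases K.eq_empty_or_nonempty with he | hne
  · refine ⟨0, le_rfl, fun x hx => ?_⟩
    rw [zero_mul, add_zero]
    by_contra hcon
    have : x ∈ K := ⟨hx, not_lt.1 hcon⟩
    simp [he] at this
  · obtain ⟨x₁, hx₁, hmin₁⟩ := hK.exists_isMinOn hne (hl.pow 2).continuousOn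
    obtain ⟨x₂, hx₂, hmin₂⟩ := hK.exists_isMinOn hne hq.continuousOn
    have hl₁ : 0 < l x₁ ^ 2 := by
      have : l x₁ ≠ 0 := fun h0 => absurd (hpos x₁ (ne_zero_of_mem_unit_sphere ⟨x₁, hx₁.1⟩) h0)
        (not_lt.2 hx₁.2)
      positivity
    have hq₂ : q x₂ ≤ 0 := hx₂.2
    refine ⟨(1 - q x₂) / l x₁ ^ 2, div_nonneg (by linarith) hl₁.le, fun x hx => ?_⟩
    by_cases hxq : q x ≤ 0
    · have h1 : l x₁ ^ 2 ≤ l x ^ 2 := hmin₁ ⟨hx, hxq⟩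
      have h2 : q x₂ ≤ q x := hmin₂ ⟨hx, hxq⟩
      have h3 : 1 - q x₂ ≤ (1 - q x₂) / l x₁ ^ 2 * l x ^ 2 := by
        rw [div_mul_eq_mul_div, le_div_iff₀ hl₁]
        exact mul_le_mul_of_nonneg_left h1 (by linarith)
      linarith
    · rw [not_le] at hxq
      have : 0 ≤ (1 - q x₂) / l x₁ ^ 2 * l x ^ 2 :=
        mul_nonneg (div_nonneg (by linarith) hl₁.le) (sq_nonneg _)
      linarith

/-- A function with positive definite Hessian is uniformly convex near the point. -/
theorem exists_convexPatch [FiniteDimensional ℝ E] {f : E → ℝ} {O : E} (hf : ContDiffAt ℝ 6 f O)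
    (h0 : f O = 0) (hd : fderiv ℝ f O ≠ 0)
    (hpos : ∀ v ≠ 0, 0 < fderiv ℝ (fderiv ℝ f) O v v) {S : Set E} (hS : S ∈ 𝓝 O) :
    ∃ r μ, ConvexPatch f O r μ ∧ Metric.ball O r ⊆ S := by
  set H := fderiv ℝ (fderiv ℝ f) with hH
  obtain ⟨m, hm, hcoer⟩ := exists_coercive (q := fun v => H O v v)
    ((H O).continuous.clm_apply continuous_id)
    (fun c x => by simp only [map_smul, _root_.smul_apply, smul_eq_mul]; ring) hpos
  have hHc : ContinuousAt H O :=
    ((hf.fderiv_right (m := 5) (by norm_num)).fderiv_right (m := 4) (by norm_num)).continuousAt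
  -- Losing at most half of the coercivity constant leaves the Hessian bounded below by `m / 2` on
  -- the ball.
  have e1 : ∀ᶠ x in 𝓝 O, ‖H x - H O‖ < m / 2 := by
    have hc : ContinuousAt (fun x => ‖H x - H O‖) O :=
      (continuous_norm (E := E →L[ℝ] E →L[ℝ] ℝ)).continuousAt.comp (hHc.sub continuousAt_const)
    refine hc.eventually_lt_const ?_
    simp only [sub_self]
    exact (norm_zero (E := E →L[ℝ] E →L[ℝ] ℝ)).trans_lt (half_pos hm)
  have e2 : ∀ᶠ x in 𝓝 O, ContDiffAt ℝ 6 f x := hf.eventually (by simp)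
  obtain ⟨r, hr, hall⟩ := Metric.eventually_nhds_iff_ball.1 (e1.and (e2.and hS))
  have hbound : ∀ x ∈ Metric.ball O r, ∀ v, m / 2 * ‖v‖ ^ 2 ≤ H x v v := by
    intro x hx v
    have h1 := hcoer v
    have h2 : |(H x - H O) v v| ≤ m / 2 * ‖v‖ ^ 2 := by
      calc |(H x - H O) v v| ≤ ‖H x - H O‖ * ‖v‖ * ‖v‖ := (H x - H O).le_opNorm₂ v v
        _ = ‖H x - H O‖ * ‖v‖ ^ 2 := by ring
        _ ≤ m / 2 * ‖v‖ ^ 2 := mul_le_mul_of_nonneg_right (hall x hx).1.le (by positivity)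
    have h3 := (abs_le.1 h2).1
    simp only [_root_.sub_apply] at h3
    linarith
  refine ⟨r, m / 2, ⟨hr, half_pos hm, fun x hx => (hall x hx).2.1, h0, hd, hpos,
    fun p hp q hq => ?_⟩, fun x hx => (hall x hx).2.2⟩
  have hmem : ∀ t ∈ Set.Icc (0 : ℝ) 1, p + t • (q - p) ∈ Metric.ball O r := fun t ht =>
    (convex_ball O r).segment_subset hp hq
      ⟨1 - t, t, by linarith [ht.2], ht.1, by ring, by module⟩
  have hline : ∀ t : ℝ, HasDerivAt (fun t : ℝ => p + t • (q - p)) (q - p) t := fun t => by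
    simpa using ((hasDerivAt_id t).smul_const (q - p)).const_add p
  have := taylor_lower_bound (g := fun t => f (p + t • (q - p)))
    (g₁ := fun t => fderiv ℝ f (p + t • (q - p)) (q - p))
    (g₂ := fun t => H (p + t • (q - p)) (q - p) (q - p)) (m := m / 2 * ‖q - p‖ ^ 2)
    (fun t ht => HasFDerivAt.comp_hasDerivAt t
      ((hall _ (hmem t ht)).2.1.differentiableAt (by norm_num)).hasFDerivAt (hline t))
    (fun t ht => by
      have h1 : HasFDerivAt (fderiv ℝ f) (H (p + t • (q - p))) (p + t • (q - p)) :=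
        (((hall _ (hmem t ht)).2.1.fderiv_right (m := 5) (by norm_num)).differentiableAt
          (by norm_num)).hasFDerivAt
      exact (ContinuousLinearMap.apply ℝ ℝ (q - p)).hasFDerivAt.comp_hasDerivAt t
        (HasFDerivAt.comp_hasDerivAt t h1 (hline t)))
    (fun t ht => hbound _ (hmem t ht) _)
  simp only [zero_smul, add_zero, one_smul, add_sub_cancel] at this
  linarith

/-- The second fundamental form in terms of the Hessian of the defining function. -/
theorem secondFundamentalForm_eq {n : ℕ} {F : Euc n → ℝ} {O u : Euc n} (hF : ContDiffAt ℝ 6 F O)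
    (hg : gradient F O ≠ 0) (hu : inner ℝ (gradient F O) u = 0) :
    secondFundamentalForm F O u u = ‖gradient F O‖⁻¹ * fderiv ℝ (fderiv ℝ F) O u u := by
  have hdF : HasFDerivAt (fderiv ℝ F) (fderiv ℝ (fderiv ℝ F) O) O :=
    ((hF.fderiv_right (m := 5) (by norm_num)).differentiableAt (by norm_num)).hasFDerivAt
  have hgd : DifferentiableAt ℝ (gradient F) O :=
    (InnerProductSpace.toDual ℝ (Euc n)).symm.differentiable.differentiableAt.comp O
      hdF.differentiableAt
  have hnd : DifferentiableAt ℝ (fun x => ‖gradient F x‖⁻¹) O :=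
    (hgd.norm ℝ hg).inv (norm_ne_zero_iff.2 hg)
  have h1 := (hnd.hasFDerivAt.smul hgd.hasFDerivAt).fderiv
  have h2 : inner ℝ (fderiv ℝ (gradient F) O u) u = fderiv ℝ (fderiv ℝ F) O u u := by
    have e1 : HasFDerivAt (fun x => (inner ℝ (gradient F x) u : ℝ)) _ O :=
      hgd.hasFDerivAt.inner ℝ (hasFDerivAt_const u O)
    have e2 : HasFDerivAt (fun x => fderiv ℝ F x u) _ O :=
      hdF.clm_apply (hasFDerivAt_const u O)
    have e3 : (fun x => (inner ℝ (gradient F x) u : ℝ)) = fun x => fderiv ℝ F x u :=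
      funext fun x => ConvexPatch.inner_gradient F x u
    rw [e3] at e1
    simpa using congrArg (fun L : Euc n →L[ℝ] ℝ => L u) (e1.unique e2)
  -- The derivative of the normalizing factor contributes only a multiple of the gradient, which is
  -- orthogonal to the tangent vector `u`.
  have h3 : fderiv ℝ (unitNormal F) O u = ‖gradient F O‖⁻¹ • fderiv ℝ (gradient F) O u +
      (fderiv ℝ (fun x => ‖gradient F x‖⁻¹) O u) • gradient F O := by
    have := congrArg (fun L : Euc n →L[ℝ] Euc n => L u) h1
    exact this
  rw [secondFundamentalForm, h3, inner_add_left, real_inner_smul_left, real_inner_smul_left, hu,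
    h2, mul_zero, add_zero]

variable {n : ℕ}

/-- A strictly convex patch with projective involutions of parallel chords is a quadric. -/
theorem ConvexPatch.exists_quadric {f : Euc n → ℝ} {O : Euc n} {r μ : ℝ} (hn : 2 ≤ n)
    (h : ConvexPatch f O r μ) (hproj : HasProjectiveChords f O r) :
    ∃ (q : QuadraticForm ℝ (Euc n)) (l : Euc n →ₗ[ℝ] ℝ) (c : ℝ), q ≠ 0 ∧
      ∀ᶠ x in 𝓝 O, f x = 0 ↔ q x + l x + c = 0 := by
  obtain ⟨r₁, hr₁, hle, hgrad, hom⟩ := h.exists_homology hproj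
  refine (h.mono hr₁ hle).exists_quadric_of_homologies hom (n := gradient f O) (fun x hx => ?_) ?_
  · rw [← ConvexPatch.inner_gradient]
    exact hgrad x hx
  · have hker : LinearMap.ker (fderiv ℝ f O : Euc n →ₗ[ℝ] ℝ) ≠ ⊥ :=
      LinearMap.ker_ne_bot_of_finrank_lt (by
        rw [Module.finrank_self, finrank_euclideanSpace_fin]
        omega)
    obtain ⟨u, hu, hu0⟩ := (Submodule.ne_bot_iff _).1 hker
    exact ⟨u, hu0, hu⟩

/-! ### Passage from unit normals and `F` to gradients and the convexified function -/

/-- The projectivity property, in terms of gradients of a defining function. -/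
theorem exists_linear_of_isLiftOf {F : Euc n → ℝ} {β : Set (Euc n)} {v : Euc n}
    (hβ : ∀ x ∈ β, gradient F x ≠ 0)
    {p : Projectivization ℝ (Euc n) → Projectivization ℝ (Euc n)} (hp : IsProjectiveInvolution p)
    (hlift : IsLiftOf (LineInvolution F β v) p) :
    ∃ M : Euc n →ₗ[ℝ] Euc n, Function.Injective M ∧ (∀ x, ∃ c : ℝ, M (M x) = c • x) ∧
      ∀ A B, IsChord F β v A B → ∃ c : ℝ, M (gradient F A) = c • gradient F B := by
  obtain ⟨⟨M, rfl⟩, hinv⟩ := hp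
  refine ⟨M.toLinearMap, M.injective, fun x => ?_, fun A B hAB => ?_⟩
  · rcases eq_or_ne x 0 with rfl | hx
    · exact ⟨0, by simp⟩
    · have h1 := hinv (Projectivization.mk ℝ x hx)
      rw [Projectivization.map_mk, Projectivization.map_mk, Projectivization.mk_eq_mk_iff'] at h1
      obtain ⟨c, hc⟩ := h1
      exact ⟨c, hc.symm⟩
  · have hunit : ∀ x ∈ β, unitNormal F x ∈ Metric.sphere (0 : Euc n) 1 := fun x hx => by
      have := norm_ne_zero_iff.2 (hβ x hx)
      rw [mem_sphere_zero_iff_norm, unitNormal, norm_smul, norm_inv, norm_norm,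
        inv_mul_cancel₀ this]
    have h1 := hlift ⟨_, hunit A hAB.1⟩ ⟨_, hunit B hAB.2.1⟩ ⟨A, B, hAB, rfl, rfl⟩
    rw [tautProj, tautProj, Projectivization.map_mk, Projectivization.mk_eq_mk_iff'] at h1
    obtain ⟨c, hc⟩ := h1
    have hA := norm_ne_zero_iff.2 (hβ A hAB.1)
    simp only [unitNormal, map_smul] at hc
    refine ⟨‖gradient F A‖ * (c * ‖gradient F B‖⁻¹), ?_⟩
    rw [mul_smul, mul_smul, hc, smul_smul, mul_inv_cancel₀ hA, one_smul]

/-- The defining function `F + (k / 2) F²`. -/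
def convexify (F : Euc n → ℝ) (k : ℝ) (x : Euc n) : ℝ := F x + k / 2 * F x ^ 2

theorem fderiv_convexify {F : Euc n → ℝ} {x : Euc n} (k : ℝ) (hF : DifferentiableAt ℝ F x) :
    fderiv ℝ (convexify F k) x = (1 + k * F x) • fderiv ℝ F x := by
  have h := hF.hasFDerivAt
  have h1 : HasFDerivAt (convexify F k) _ x := h.add ((h.pow 2).const_mul (k / 2))
  rw [h1.fderiv]
  ext v
  simp
  ring

theorem fderiv_fderiv_convexify {F : Euc n → ℝ} {O : Euc n} (k : ℝ) (hF : ContDiffAt ℝ 6 F O)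
    (h0 : F O = 0) (v : Euc n) :
    fderiv ℝ (fderiv ℝ (convexify F k)) O v v =
      fderiv ℝ (fderiv ℝ F) O v v + k * fderiv ℝ F O v ^ 2 := by
  have hev : fderiv ℝ (convexify F k) =ᶠ[𝓝 O] fun x => (1 + k * F x) • fderiv ℝ F x := by
    filter_upwards [hF.eventually (by simp)] with x hx
    exact fderiv_convexify k (hx.differentiableAt (by norm_num))
  have hdF : HasFDerivAt (fderiv ℝ F) (fderiv ℝ (fderiv ℝ F) O) O :=
    ((hF.fderiv_right (m := 5) (by norm_num)).differentiableAt (by norm_num)).hasFDerivAt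
  have h1 : HasFDerivAt (fun x => (1 + k * F x) • fderiv ℝ F x) _ O :=
    (((hF.differentiableAt (by norm_num)).hasFDerivAt.const_mul k).const_add 1).smul hdF
  rw [hev.fderiv_eq, h1.fderiv]
  simp [h0]
  ring

end ProjBilliard

end

theorem theorem1p11 (n : ℕ) (hn : 2 ≤ n)
    (α : Set (ProjBilliard.Euc n)) (O : ProjBilliard.Euc n) (F : ProjBilliard.Euc n → ℝ)
    -- `α` is a `C⁶` germ of hypersurface at `O`, with positive definite second fundamental form
    (hF : ProjBilliard.IsDefiningFunctionAt F α O)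
    (hII : ProjBilliard.HasPosDefSecondFundamentalForm F O)
    -- some representative `α ∩ U` of the germ has the projectivity property
    (hproj : ∃ U ∈ 𝓝 O, ∀ v : ProjBilliard.Euc n, v ≠ 0 →
      ProjBilliard.MeetsTwice (α ∩ U) v →
        ∃ f : Projectivization ℝ (ProjBilliard.Euc n) → Projectivization ℝ (ProjBilliard.Euc n),
          ProjBilliard.IsProjectiveInvolution f ∧
            ProjBilliard.IsLiftOf (ProjBilliard.LineInvolution F (α ∩ U) v) f) :
    -- the germ of `α` at `O` is the germ of a quadric
    ∃ Γ : Set (ProjBilliard.Euc n), ProjBilliard.IsQuadric Γ ∧ α =ᶠ[𝓝 O] Γ := by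
  open ProjBilliard in
  obtain ⟨U, hU, hproj⟩ := hproj
  have hmem := hF.eventually_mem_iff
  have h0 : F O = 0 := hmem.self_of_nhds.1 hF.mem
  have hC := hF.contDiffAt
  have hgn : 0 < ‖gradient F O‖ := norm_pos_iff.2 hF.gradient_ne_zero
  -- At `O` the Hessian of `convexify F k` is that of `F` plus `k (dF)²`; positivity on the tangent
  -- hyperplane, which is the hypothesis on the second fundamental form, suffices for large `k`.
  obtain ⟨k, hk, hkpos⟩ := exists_pos_add_sq (q := fun v => fderiv ℝ (fderiv ℝ F) O v v)
    (l := fun v => fderiv ℝ F O v)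
    ((fderiv ℝ (fderiv ℝ F) O).continuous.clm_apply continuous_id) (fderiv ℝ F O).continuous
    (fun c x => by simp only [map_smul, smul_apply, smul_eq_mul]; ring)
    (fun c x => by simp only [map_smul, smul_eq_mul])
    (fun v hv hv0 => by
      have hvi : inner ℝ (gradient F O) v = 0 := by rw [ConvexPatch.inner_gradient, hv0]
      have h1 := hII v hvi hv
      rw [secondFundamentalForm_eq hC hF.gradient_ne_zero hvi] at h1
      exact (pos_iff_pos_of_mul_pos h1).1 (inv_pos.2 hgn))
  have hd0 : fderiv ℝ (convexify F k) O = fderiv ℝ F O := by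
    rw [fderiv_convexify k (hC.differentiableAt (by norm_num)), h0, mul_zero, add_zero, one_smul]
  have hCf : ContDiffAt ℝ 6 (convexify F k) O :=
    hC.add (contDiffAt_const.mul (hC.pow 2))
  have hfd : fderiv ℝ (convexify F k) O ≠ 0 := by
    rw [hd0]
    intro h
    refine hF.gradient_ne_zero (ext_inner_right ℝ fun x => ?_)
    rw [ConvexPatch.inner_gradient, h, inner_zero_left]
    rfl
  -- Since `F + (k / 2) F² = F (1 + (k / 2) F)`, positivity of the second factor makes the zero sets
  -- coincide.
  have hfactor : ∀ᶠ x in 𝓝 O, 0 < 1 + k / 2 * F x := by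
    have hc : ContinuousAt (fun x => 1 + k / 2 * F x) O :=
      continuousAt_const.add (continuousAt_const.mul hC.continuousAt)
    exact hc.eventually_const_lt (by simp [h0])
  have hdiff : ∀ᶠ x in 𝓝 O, DifferentiableAt ℝ F x := by
    filter_upwards [hC.eventually (by simp)] with x hx using hx.differentiableAt (by norm_num)
  obtain ⟨r, μ, hpatch, hsub⟩ := exists_convexPatch hCf (by simp [convexify, h0]) hfd
    (fun v hv => by rw [fderiv_fderiv_convexify k hC h0]; exact hkpos v hv)
    (Filter.inter_mem hU (hmem.and (hfactor.and hdiff)))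
  have hzero : ∀ x ∈ Metric.ball O r, convexify F k x = 0 ↔ F x = 0 := by
    intro x hx
    have h1 := (hsub hx).2.2.1
    have h2 : convexify F k x = F x * (1 + k / 2 * F x) := by rw [convexify]; ring
    rw [h2, mul_eq_zero, or_iff_left h1.ne']
  have hfderiv : ∀ x ∈ Metric.ball O r, F x = 0 →
      fderiv ℝ (convexify F k) x = fderiv ℝ F x := by
    intro x hx hFx
    rw [fderiv_convexify k (hsub hx).2.2.2, hFx, mul_zero, add_zero, one_smul]
  have hgrad : ∀ x ∈ Metric.ball O r, F x = 0 →
      gradient (convexify F k) x = gradient F x := by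
    intro x hx hFx
    rw [gradient, gradient, hfderiv x hx hFx]
  have hchords : HasProjectiveChords (convexify F k) O r := by
    intro v hv hchord
    have hin : ∀ x ∈ Metric.ball O r, convexify F k x = 0 → x ∈ α ∩ U := fun x hx hfx =>
      ⟨(hsub hx).2.1.2 ((hzero x hx).1 hfx), (hsub hx).1⟩
    obtain ⟨A, hA, B, hB, hfA, hfB, hAB, t, ht⟩ := hchord
    obtain ⟨p, hp, hlift⟩ := hproj v hv ⟨A, hin A hA hfA, B, hin B hB hfB, hAB, t, ht⟩
    -- The lifting property restricts to smaller representatives; inside the ball the gradients on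
    -- the hypersurface are nonzero.
    have hlift' : IsLiftOf (LineInvolution F (α ∩ U ∩ Metric.ball O r) v) p := by
      rintro a b ⟨A', B', ⟨h1, h2, h3⟩, ha, hb⟩
      exact hlift a b ⟨A', B', ⟨h1.1, h2.1, h3⟩, ha, hb⟩
    obtain ⟨M, hM, hMM, hMc⟩ := exists_linear_of_isLiftOf (fun x hx h => by
      have hFx : F x = 0 := (hsub hx.2).2.1.1 hx.1.1
      refine hpatch.fderiv_ne_zero hx.2 ((hzero x hx.2).2 hFx)
        (ContinuousLinearMap.ext fun y => ?_)
      rw [hfderiv x hx.2 hFx, ← ConvexPatch.inner_gradient, h, inner_zero_left]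
      rfl) hp hlift'
    refine ⟨M, hM, hMM, fun A hA B hB hfA hfB hpar hcase => ?_⟩
    have hFA := (hzero A hA).1 hfA
    have hFB := (hzero B hB).1 hfB
    rw [hgrad A hA hFA, hgrad B hB hFB]
    refine hMc A B ⟨⟨hin A hA hfA, hA⟩, ⟨hin B hB hfB, hB⟩, hpar, ?_⟩
    rwa [ConvexPatch.inner_gradient, ← hfderiv A hA hFA]
  obtain ⟨q, l, c, hq, hev⟩ := hpatch.exists_quadric hn hchords
  refine ⟨{x | q x + l x + c = 0}, ⟨q, l, c, hq, rfl⟩, ?_⟩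
  rw [eventuallyEq_set]
  filter_upwards [hev, Metric.isOpen_ball.mem_nhds hpatch.base_mem] with x hx hxr
  rw [(hsub hxr).2.1, ← hzero x hxr, hx]
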